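/- Fix $\beta\in[0,2)$ and put $h=(2-\beta)\pi^2$ and, for $N_t\in\mathbb N$, $T=\sqrt{N_t h/4}$. With principal square roots, let $$f(u,z)=\frac{z}{\pi}\,\frac{1}{\sqrt u}\,\frac{e^{\sqrt u-T}}{e^{2(\sqrt u-T)}+z},\qquad \delta(u)=\mu(u)+\frac{i}{2}\cot\Big(\frac{\pi u}{h}\Big),\qquad \mu(u)=\begin{cases}-\tfrac12,&\operatorname{Im}u\ge 0,\\ \tfrac12,&\operatorname{Im}u<0.\end{cases}$$ Assume the following conjectured bound (for this $\beta$): as $N_t\to\infty$, $$\Big|\int_\Gamma f(u,z)\,\delta(u)\,du\Big|=\mathcal O(e^{-T}),$$ uniformly for $z=r e^{\pm i\beta\pi/2}$ with $r\in[e^{4+2\beta-2T},1]$, where $\Gamma$ is the positively oriented boundary of the rectangle $[1-\beta/2,\;4T^2+1-\beta/2]\times[-ai,ai]$ with $a=2\pi\,(T+\tfrac12\log r)$. Then, for every $N_1\in\mathbb N$, there are nonzero coefficients $a_1,\dots,a_{N_1}\in\mathbb C$ and a complex polynomial $b$ of degree $N_2=N_2(N_1)$, with $N_2=\mathcal O(\sqrt{N_1})$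 as $N_1\to\infty$, such that the lightning + polynomial approximant $$r(z)=\sum_{j=1}^{N_1}\frac{a_j}{z-p_j}+b(z)$$ with tapered lightning poles $$p_j=-\exp\!\big(-\sigma(\sqrt{N_1}-\sqrt j)\big),\quad 1\le j\le N_1,\qquad \sigma=2\sqrt{2-\beta}\,\pi,$$ satisfies, with $N=N_1+N_2$, $$|r(z)-\sqrt z|=\mathcal O\big(e^{-\pi\sqrt{(2-\beta)N}}\big)\qquad\text{as } N_1\to\infty \text{ (equivalently, as } N\to\infty),$$ uniformly for $z$ in the V-shaped domain $[0,1]e^{\pm i\beta\pi/2}=\{\rho e^{\pm i\beta\pi/2}:0\le\rho\le1\}$. (The implied constants may depend on $\beta$. The zero polynomial is counted as having degree $0$.) -/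

import Mathlib

open Filter Asymptotics

/-- The V-shaped domain `[0,1]e^{±iβπ/2}`. -/
def vShape (β : ℝ) : Set ℂ :=
  {z | ∃ r : ℝ, 0 ≤ r ∧ r ≤ 1 ∧
    (z = r * Complex.exp (Complex.I * (β * Real.pi / 2)) ∨
      z = r * Complex.exp (-(Complex.I * (β * Real.pi / 2))))}

/-- The integrand (with principal square root)
`f(u,z) = (z/π) (1/√u) e^{√u - T} / (e^{2(√u - T)} + z)`. -/
noncomputable def trapIntegrand (T : ℝ) (z u : ℂ) : ℂ :=
  z / Real.pi * (1 / Complex.sqrt u) *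
    (Complex.exp (Complex.sqrt u - T) / (Complex.exp (2 * (Complex.sqrt u - T)) + z))

/-- The function `μ`: `-1/2` for `Im u ≥ 0` and `1/2` for `Im u < 0`. -/
noncomputable def muFun (u : ℂ) : ℂ := if 0 ≤ u.im then -(1 / 2) else 1 / 2

/-- The function `m(u) = -(i/2) cot(πu/h)`. -/
noncomputable def mFun (h : ℝ) (u : ℂ) : ℂ :=
  -(Complex.I / 2) * Complex.cot (Real.pi * u / h)

/-- The function `δ = μ - m`. -/
noncomputable def deltaFun (h : ℝ) (u : ℂ) : ℂ := muFun u - mFun h u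

/-- The contour integral of `F` along the positively oriented (counterclockwise) boundary of
the rectangle `[x₀,x₁] × [-ai, ai]`: bottom, right, top and left side. -/
noncomputable def rectContourIntegral (x₀ x₁ a : ℝ) (F : ℂ → ℂ) : ℂ :=
  (∫ x in x₀..x₁, F (x + (-a : ℝ) * Complex.I))
    + Complex.I * (∫ y in (-a)..a, F (x₁ + y * Complex.I))
    - (∫ x in x₀..x₁, F (x + a * Complex.I))
    - Complex.I * (∫ y in (-a)..a, F (x₀ + y * Complex.I))

/-- The step size `h = (2-β)π²`. -/
noncomputable def stepSize (β : ℝ) : ℝ := (2 - β) * Real.pi ^ 2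

/-- The truncation parameter `T = √(N_t h / 4)`. -/
noncomputable def truncParam (h : ℝ) (Nt : ℕ) : ℝ := Real.sqrt (Nt * h / 4)

/-- The conjectured bound on the contour integral, for fixed `β`: with `h = (2-β)π²`,
`T = √(N_t h / 4)` and `z = r e^{±iβπ/2}`, one has `|∫_Γ f(u,z) δ(u) du| = O(e^{-T})` as
`N_t → ∞`, uniformly for `r ∈ [e^{4+2β-2T}, 1]` and both signs, where `Γ` is the boundary of
`[1-β/2, 4T²+1-β/2] × [-ai, ai]` with `a = 2π(T + (log r)/2)`. -/
def ContourBoundConjecture (β : ℝ) : Prop :=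
  ∃ C : ℝ, ∀ᶠ Nt : ℕ in atTop, ∀ T : ℝ, T = truncParam (stepSize β) Nt →
    ∀ r : ℝ, Real.exp (4 + 2 * β - 2 * T) ≤ r → r ≤ 1 →
    ∀ z : ℂ, (z = r * Complex.exp (Complex.I * (β * Real.pi / 2)) ∨
        z = r * Complex.exp (-(Complex.I * (β * Real.pi / 2)))) →
      ‖rectContourIntegral (1 - β / 2) (4 * T ^ 2 + 1 - β / 2)
          (2 * Real.pi * (T + 1 / 2 * Real.log r))
          (fun u => trapIntegrand T z u * deltaFun (stepSize β) u)‖ ≤ C * Real.exp (-T)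

/-- The tapered lightning poles on `[-1,0]`: `p_j = -exp(-σ(√N₁ - √j))`, `1 ≤ j ≤ N₁`. -/
noncomputable def taperedPole (σ : ℝ) (N₁ j : ℕ) : ℝ :=
  -Real.exp (-σ * (Real.sqrt N₁ - Real.sqrt j))

/-- The lightning + polynomial function
`r(z) = ∑_{j=1}^{N₁} a_j / (z - p_j) + b(z)` with tapered lightning poles. -/
noncomputable def lightningPoly (σ : ℝ) (N₁ : ℕ) (a : ℕ → ℂ) (b : Polynomial ℂ) (z : ℂ) : ℂ :=
  (∑ j ∈ Finset.Icc 1 N₁, a j / (z - taperedPole σ N₁ j)) + b.eval z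

/-! With $w=\sqrt z$ and $t=e^{\sqrt x-T}$, $\int f(x,z)\,dx$ becomes
$\frac{2z}{\pi}\int\frac{dt}{t^2+z}$, an arctangent integral equal to $w$ over $(0,\infty)$. The
trapezoidal rule with step $h$ turns it into a sum of simple fractions with poles
$-e^{2(\sqrt{jh}-T)}$, and with $N_t=4N_1$ nodes the first $N_1$ of these are exactly the tapered
poles.

The error of the rule comes from residues (`trapezoid_sum_eq`): sum minus integral is a contour
integral of $f\delta$, which the conjecture bounds, plus the contributions of the two poles of $f$
inside the contour. The choice $h=(2-\beta)\pi^2$ makes the latter $O(e^{-T})$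
(`norm_pole_term_le`), as is the truncation error (`norm_integral_trapIntegrand_sub_le`). For $|z|$
below about $e^{-2T}$ the conjecture says nothing, but there the sum and $\sqrt z$ are separately
$O(e^{-T})$ (`exists_trapezoid_error_bound`).

The $3N_1$ remaining poles lie on $(-\infty,-1]$, while the V lies in a disc about $1$ of radius
less than $2$. Taylor polynomials at $1$ therefore replace these fractions at a uniform geometric
rate, and $O(\sqrt{N_1})$ terms suffice (`norm_lightningPoly_sub_trapezoid_le`). Since
$T=\pi\sqrt{(2-\beta)N_1}$ and $\sqrt{N_1+O(\sqrt{N_1})}=\sqrt{N_1}+O(1)$, counting the polynomial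
degree in $N$ costs only a constant factor. -/

/-! ### Rectangle integrals and the residue theorem for simple poles. -/

/-- The contour integral of `F` along the counterclockwise boundary of `[x₀,x₁] × [y₀,y₁]`. -/
noncomputable def rectIntegral (x₀ x₁ y₀ y₁ : ℝ) (F : ℂ → ℂ) : ℂ :=
  (∫ x in x₀..x₁, F (x + y₀ * Complex.I))
    + Complex.I * (∫ y in y₀..y₁, F (x₁ + y * Complex.I))
    - (∫ x in x₀..x₁, F (x + y₁ * Complex.I))
    - Complex.I * (∫ y in y₀..y₁, F (x₀ + y * Complex.I))

/-- The boundary of the rectangle `[x₀,x₁] × [y₀,y₁]`. -/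
def rectBoundary (x₀ x₁ y₀ y₁ : ℝ) : Set ℂ :=
  {u | u ∈ Set.Icc x₀ x₁ ×ℂ Set.Icc y₀ y₁ ∧ (u.re = x₀ ∨ u.re = x₁ ∨ u.im = y₀ ∨ u.im = y₁)}

lemma horizontal_mem_rectBoundary {x₀ x₁ y₀ y₁ x y : ℝ} (hy : y₀ ≤ y₁) (hx : x ∈ Set.Icc x₀ x₁)
    (h : y = y₀ ∨ y = y₁) : (x + y * Complex.I : ℂ) ∈ rectBoundary x₀ x₁ y₀ y₁ := by
  rcases h with rfl | rfl <;> simp_all [rectBoundary, Complex.mem_reProdIm]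

lemma vertical_mem_rectBoundary {x₀ x₁ y₀ y₁ x y : ℝ} (hx : x₀ ≤ x₁) (hy : y ∈ Set.Icc y₀ y₁)
    (h : x = x₀ ∨ x = x₁) : (x + y * Complex.I : ℂ) ∈ rectBoundary x₀ x₁ y₀ y₁ := by
  rcases h with rfl | rfl <;> simp_all [rectBoundary, Complex.mem_reProdIm]

lemma rectIntegral_congr {x₀ x₁ y₀ y₁ : ℝ} (hx : x₀ ≤ x₁) (hy : y₀ ≤ y₁) {F G : ℂ → ℂ}
    (h : Set.EqOn F G (rectBoundary x₀ x₁ y₀ y₁)) :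
    rectIntegral x₀ x₁ y₀ y₁ F = rectIntegral x₀ x₁ y₀ y₁ G := by
  unfold rectIntegral
  congr 1; congr 1; congr 1
  · refine intervalIntegral.integral_congr fun x hx' => h ?_
    exact horizontal_mem_rectBoundary hy (by rwa [Set.uIcc_of_le hx] at hx') (Or.inl rfl)
  · congr 1
    refine intervalIntegral.integral_congr fun x hx' => h ?_
    exact vertical_mem_rectBoundary hx (by rwa [Set.uIcc_of_le hy] at hx') (Or.inr rfl)
  · refine intervalIntegral.integral_congr fun x hx' => h ?_
    exact horizontal_mem_rectBoundary hy (by rwa [Set.uIcc_of_le hx] at hx') (Or.inr rfl)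
  · congr 1
    refine intervalIntegral.integral_congr fun x hx' => h ?_
    exact vertical_mem_rectBoundary hx (by rwa [Set.uIcc_of_le hy] at hx') (Or.inl rfl)

lemma intervalIntegrable_horizontal {x₀ x₁ y₀ y₁ y : ℝ} (hx : x₀ ≤ x₁) (hy : y₀ ≤ y₁) {F : ℂ → ℂ}
    (hF : ContinuousOn F (rectBoundary x₀ x₁ y₀ y₁)) (h : y = y₀ ∨ y = y₁) :
    IntervalIntegrable (fun x : ℝ => F (x + y * Complex.I)) MeasureTheory.volume x₀ x₁ := by
  refine ContinuousOn.intervalIntegrable (hF.comp (by fun_prop) fun x hx' => ?_)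
  exact horizontal_mem_rectBoundary hy (by rwa [Set.uIcc_of_le hx] at hx') h

lemma intervalIntegrable_vertical {x₀ x₁ y₀ y₁ x : ℝ} (hx : x₀ ≤ x₁) (hy : y₀ ≤ y₁) {F : ℂ → ℂ}
    (hF : ContinuousOn F (rectBoundary x₀ x₁ y₀ y₁)) (h : x = x₀ ∨ x = x₁) :
    IntervalIntegrable (fun y : ℝ => F (x + y * Complex.I)) MeasureTheory.volume y₀ y₁ := by
  refine ContinuousOn.intervalIntegrable (hF.comp (by fun_prop) fun y hy' => ?_)
  exact vertical_mem_rectBoundary hx (by rwa [Set.uIcc_of_le hy] at hy') h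

lemma rectIntegral_add {x₀ x₁ y₀ y₁ : ℝ} (hx : x₀ ≤ x₁) (hy : y₀ ≤ y₁) {F G : ℂ → ℂ}
    (hF : ContinuousOn F (rectBoundary x₀ x₁ y₀ y₁))
    (hG : ContinuousOn G (rectBoundary x₀ x₁ y₀ y₁)) :
    rectIntegral x₀ x₁ y₀ y₁ (fun u => F u + G u) =
      rectIntegral x₀ x₁ y₀ y₁ F + rectIntegral x₀ x₁ y₀ y₁ G := by
  unfold rectIntegral
  rw [intervalIntegral.integral_add (intervalIntegrable_horizontal hx hy hF (Or.inl rfl))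
      (intervalIntegrable_horizontal hx hy hG (Or.inl rfl)),
    intervalIntegral.integral_add (intervalIntegrable_horizontal hx hy hF (Or.inr rfl))
      (intervalIntegrable_horizontal hx hy hG (Or.inr rfl)),
    intervalIntegral.integral_add (intervalIntegrable_vertical hx hy hF (Or.inl rfl))
      (intervalIntegrable_vertical hx hy hG (Or.inl rfl)),
    intervalIntegral.integral_add (intervalIntegrable_vertical hx hy hF (Or.inr rfl))
      (intervalIntegrable_vertical hx hy hG (Or.inr rfl))]
  ring

lemma rectIntegral_const_mul (x₀ x₁ y₀ y₁ : ℝ) (c : ℂ) (F : ℂ → ℂ) :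
    rectIntegral x₀ x₁ y₀ y₁ (fun u => c * F u) = c * rectIntegral x₀ x₁ y₀ y₁ F := by
  unfold rectIntegral
  simp only [intervalIntegral.integral_const_mul]
  ring

lemma rectIntegral_eq_zero {x₀ x₁ y₀ y₁ : ℝ} (hx : x₀ ≤ x₁) (hy : y₀ ≤ y₁) {F : ℂ → ℂ}
    (hF : DifferentiableOn ℂ F (Set.Icc x₀ x₁ ×ℂ Set.Icc y₀ y₁)) :
    rectIntegral x₀ x₁ y₀ y₁ F = 0 := by
  have := Complex.integral_boundary_rect_eq_zero_of_differentiableOn F (x₀ + y₀ * Complex.I)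
    (x₁ + y₁ * Complex.I) (by simpa [Set.uIcc_of_le hx, Set.uIcc_of_le hy] using hF)
  unfold rectIntegral
  simp at this
  linear_combination this

lemma hasDerivAt_horizontal (F : ℂ → ℂ) {F' : ℂ} {y x : ℝ}
    (h : HasDerivAt F F' (x + y * Complex.I)) :
    HasDerivAt (fun x : ℝ => F (x + y * Complex.I)) F' x := by
  have h1 : HasDerivAt (fun x : ℝ => (x + y * Complex.I : ℂ)) 1 x :=
    (Complex.ofRealCLM.hasDerivAt (x := x)).add_const _
  have h2 := h.comp x h1
  rw [mul_one] at h2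
  exact h2

lemma hasDerivAt_vertical (F : ℂ → ℂ) {F' : ℂ} {y x : ℝ}
    (h : HasDerivAt F F' (x + y * Complex.I)) :
    HasDerivAt (fun y : ℝ => F (x + y * Complex.I)) (F' * Complex.I) y := by
  have h1 : HasDerivAt (fun y : ℝ => (x + y * Complex.I : ℂ)) (1 * Complex.I) y :=
    ((Complex.ofRealCLM.hasDerivAt (x := y)).mul_const _).const_add _
  have h2 := h.comp y h1
  rw [one_mul] at h2
  exact h2

lemma integral_horizontal_eq_sub {F F' : ℂ → ℂ} {a b y : ℝ}
    (h : ∀ x ∈ Set.uIcc a b, HasDerivAt F (F' (x + y * Complex.I)) (x + y * Complex.I))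
    (hc : ContinuousOn (fun x : ℝ => F' (x + y * Complex.I)) (Set.uIcc a b)) :
    ∫ x in a..b, F' (x + y * Complex.I) = F (b + y * Complex.I) - F (a + y * Complex.I) :=
  intervalIntegral.integral_eq_sub_of_hasDerivAt (f := fun x : ℝ => F (x + y * Complex.I))
    (fun x hx => hasDerivAt_horizontal F (h x hx)) hc.intervalIntegrable

lemma integral_vertical_eq_sub {F F' : ℂ → ℂ} {a b x : ℝ}
    (h : ∀ y ∈ Set.uIcc a b, HasDerivAt F (F' (x + y * Complex.I)) (x + y * Complex.I))
    (hc : ContinuousOn (fun y : ℝ => F' (x + y * Complex.I)) (Set.uIcc a b)) :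
    Complex.I * ∫ y in a..b, F' (x + y * Complex.I) =
      F (x + b * Complex.I) - F (x + a * Complex.I) := by
  rw [mul_comm, ← intervalIntegral.integral_mul_const]
  exact intervalIntegral.integral_eq_sub_of_hasDerivAt (f := fun y : ℝ => F (x + y * Complex.I))
    (fun y hy => hasDerivAt_vertical F (h y hy)) (hc.mul continuousOn_const).intervalIntegrable

/-- On three sides $\log(u-p)$ is an antiderivative; the left side crosses its cut, so $\log(p-u)$
is used there. The mismatch at each left corner is $\pi i$. -/
lemma rectIntegral_inv_sub {x₀ x₁ y₀ y₁ : ℝ} {p : ℂ} (h0 : x₀ < p.re) (h1 : p.re < x₁)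
    (h2 : y₀ < p.im) (h3 : p.im < y₁) :
    rectIntegral x₀ x₁ y₀ y₁ (fun u => (u - p)⁻¹) = 2 * Real.pi * Complex.I := by
  have hlog : ∀ u : ℂ, u - p ∈ Complex.slitPlane →
      HasDerivAt (fun u => Complex.log (u - p)) (u - p)⁻¹ u := fun u hu => by
    simpa using ((hasDerivAt_id u).sub_const p).clog hu
  have hlog' : ∀ u : ℂ, p - u ∈ Complex.slitPlane →
      HasDerivAt (fun u => Complex.log (p - u)) (u - p)⁻¹ u := fun u hu => by
    have := ((hasDerivAt_id u).const_sub p).clog hu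
    simp only [id_eq] at this
    rw [neg_div, one_div, ← inv_neg, neg_sub] at this
    exact this
  have hc : ∀ (g : ℝ → ℂ) (s : Set ℝ), Continuous g → (∀ x ∈ s, g x - p ≠ 0) →
      ContinuousOn (fun x => (g x - p)⁻¹) s := fun g s hg h =>
    ContinuousOn.inv₀ (by fun_prop) h
  have hbot : ∫ x in x₀..x₁, ((x + y₀ * Complex.I : ℂ) - p)⁻¹ = _ :=
    integral_horizontal_eq_sub (F := fun u => Complex.log (u - p)) (F' := fun u => (u - p)⁻¹)
      (fun x _ => hlog _ (by
        rw [Complex.mem_slitPlane_iff]; right; simp; linarith))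
      (hc _ _ (by fun_prop) fun x _ h => by
        have := congrArg Complex.im h; simp at this; linarith)
  have htop : ∫ x in x₀..x₁, ((x + y₁ * Complex.I : ℂ) - p)⁻¹ = _ :=
    integral_horizontal_eq_sub (F := fun u => Complex.log (u - p)) (F' := fun u => (u - p)⁻¹)
      (fun x _ => hlog _ (by
        rw [Complex.mem_slitPlane_iff]; right; simp; linarith))
      (hc _ _ (by fun_prop) fun x _ h => by
        have := congrArg Complex.im h; simp at this; linarith)
  have hright : Complex.I * ∫ y in y₀..y₁, ((x₁ + y * Complex.I : ℂ) - p)⁻¹ = _ :=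
    integral_vertical_eq_sub (F := fun u => Complex.log (u - p)) (F' := fun u => (u - p)⁻¹)
      (fun x _ => hlog _ (by
        rw [Complex.mem_slitPlane_iff]; left; simp; linarith))
      (hc _ _ (by fun_prop) fun x _ h => by
        have := congrArg Complex.re h; simp at this; linarith)
  have hleft : Complex.I * ∫ y in y₀..y₁, ((x₀ + y * Complex.I : ℂ) - p)⁻¹ = _ :=
    integral_vertical_eq_sub (F := fun u => Complex.log (p - u)) (F' := fun u => (u - p)⁻¹)
      (fun x _ => hlog' _ (by
        rw [Complex.mem_slitPlane_iff]; left; simp; linarith))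
      (hc _ _ (by fun_prop) fun x _ h => by
        have := congrArg Complex.re h; simp at this; linarith)
  have hneg : ∀ w : ℂ, 0 < w.im → Complex.log w - Complex.log (-w) = Real.pi * Complex.I := by
    intro w hw
    rw [Complex.log, Complex.log, Complex.arg_neg_eq_arg_sub_pi_of_im_pos hw, norm_neg]
    push_cast; ring
  have e1 := hneg (x₀ + y₁ * Complex.I - p) (by simp; linarith)
  have e2 := hneg (p - (x₀ + y₀ * Complex.I)) (by simp; linarith)
  rw [neg_sub] at e1 e2
  unfold rectIntegral
  rw [hbot, htop, hright, hleft]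
  linear_combination e1 + e2

open Topology in
/-- The residue theorem for a rectangle and a function with finitely many simple poles. -/
theorem rectIntegral_eq_sum_residues {x₀ x₁ y₀ y₁ : ℝ} (hx : x₀ ≤ x₁) (hy : y₀ ≤ y₁)
    (S : Finset ℂ) (c : ℂ → ℂ) (hS : ∀ p ∈ S, p ∈ Set.Ioo x₀ x₁ ×ℂ Set.Ioo y₀ y₁) :
    ∀ F : ℂ → ℂ, DifferentiableOn ℂ F ((Set.Icc x₀ x₁ ×ℂ Set.Icc y₀ y₁) \ S) →
    (∀ p ∈ S, Tendsto (fun u => (u - p) * F u) (𝓝[≠] p) (𝓝 (c p))) →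
    rectIntegral x₀ x₁ y₀ y₁ F = 2 * Real.pi * Complex.I * ∑ p ∈ S, c p := by
  classical
  induction S using Finset.induction_on with
  | empty =>
    intro F hF _
    simpa using rectIntegral_eq_zero hx hy (by simpa using hF)
  | insert p S hp ih =>
    intro F hF hlim
    have hpR := hS p (Finset.mem_insert_self p S)
    have hopen : IsOpen (Set.Ioo x₀ x₁ ×ℂ Set.Ioo y₀ y₁) := isOpen_Ioo.reProdIm isOpen_Ioo
    set R := Set.Icc x₀ x₁ ×ℂ Set.Icc y₀ y₁ with hR
    have hsub : Set.Ioo x₀ x₁ ×ℂ Set.Ioo y₀ y₁ ⊆ R := fun u hu =>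
      ⟨Set.Ioo_subset_Icc_self hu.1, Set.Ioo_subset_Icc_self hu.2⟩
    have hnhds : R \ S ∈ 𝓝 p := by
      refine Filter.inter_mem (mem_of_superset (hopen.mem_nhds hpR) hsub) ?_
      exact S.finite_toSet.isClosed.isOpen_compl.mem_nhds (by simpa using hp)
    -- By removability `φ` is holomorphic at `p`, so `dslope φ p` is `F` with its pole at `p`
    -- subtracted, and induction on the set of poles applies to it.
    set φ : ℂ → ℂ := Function.update (fun u => (u - p) * F u) p (c p) with hφ
    have hφp : φ p = c p := Function.update_self ..
    have hφu : ∀ u, u ≠ p → φ u = (u - p) * F u := fun u hu => Function.update_of_ne hu ..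
    have hφd : DifferentiableOn ℂ φ (R \ S) := by
      rw [← Complex.differentiableOn_compl_singleton_and_continuousAt_iff hnhds]
      refine ⟨?_, continuousAt_update_same.2 (hlim p (Finset.mem_insert_self p S))⟩
      have : DifferentiableOn ℂ (fun u => (u - p) * F u) ((R \ S) \ {p}) :=
        DifferentiableOn.mul (by fun_prop) (hF.mono fun u hu => ⟨hu.1.1, by
          have h1 := hu.1.2
          have h2 := hu.2
          simp_all⟩)
      exact this.congr fun u hu => hφu u hu.2
    set G := dslope φ p with hG
    have hGd : DifferentiableOn ℂ G (R \ S) := (Complex.differentiableOn_dslope hnhds).2 hφd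
    have hGu : ∀ u, u ≠ p → F u = G u + c p * (u - p)⁻¹ := fun u hu => by
      have : u - p ≠ 0 := sub_ne_zero.2 hu
      rw [hG, dslope_of_ne _ hu, slope_def_field, hφp, hφu u hu]
      field_simp
      ring
    have hbd : ∀ u ∈ rectBoundary x₀ x₁ y₀ y₁, u ∉ insert p S := fun u hu hmem => by
      obtain ⟨⟨h1, h2⟩, ⟨h3, h4⟩⟩ := hS u hmem
      rcases hu.2 with h | h | h | h <;> linarith
    have hbp : ∀ u ∈ rectBoundary x₀ x₁ y₀ y₁, u ≠ p := fun u hu h =>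
      hbd u hu (h ▸ Finset.mem_insert_self p S)
    rw [rectIntegral_congr hx hy (G := fun u => G u + c p * (u - p)⁻¹)
        fun u hu => hGu u (hbp u hu),
      rectIntegral_add hx hy
        (hGd.continuousOn.mono fun u hu => ⟨hu.1, fun h => hbd u hu (Finset.mem_insert_of_mem h)⟩)
        (G := fun u => c p * (u - p)⁻¹)
        (continuousOn_const.mul (ContinuousOn.inv₀ (by fun_prop)
          fun u hu => sub_ne_zero.2 (hbp u hu))),
      rectIntegral_const_mul, rectIntegral_inv_sub hpR.1.1 hpR.1.2 hpR.2.1 hpR.2.2,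
      Finset.sum_insert hp,
      ih (fun q hq => hS q (Finset.mem_insert_of_mem hq)) G hGd fun q hq => ?_]
    · ring
    · have hqp : q ≠ p := fun h => hp (h ▸ hq)
      have h1 := hlim q (Finset.mem_insert_of_mem hq)
      have h2 : Tendsto (fun u : ℂ => (u - q) * (c p * (u - p)⁻¹)) (𝓝[≠] q) (𝓝 0) := by
        have : ContinuousAt (fun u : ℂ => (u - q) * (c p * (u - p)⁻¹)) q :=
          ContinuousAt.mul (by fun_prop) (continuousAt_const.mul
            (ContinuousAt.inv₀ (by fun_prop) (sub_ne_zero.2 hqp)))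
        have h3 := this.tendsto
        simp only [sub_self, zero_mul] at h3
        exact h3.mono_left nhdsWithin_le_nhds
      have h3 := h1.sub h2
      rw [sub_zero] at h3
      refine h3.congr' ?_
      have : ∀ᶠ u in 𝓝[≠] q, u ≠ p :=
        eventually_nhdsWithin_of_eventually_nhds (isOpen_ne.mem_nhds hqp)
      filter_upwards [this] with u hu
      rw [hGu u hu]; ring

-- The residue of $N/g$ at a simple zero of $g$; it serves both the poles of $f$ and those of the
-- cotangent.
open Topology in
lemma tendsto_sub_mul_div {N g : ℂ → ℂ} {g' p : ℂ} (hN : ContinuousAt N p)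
    (hg : HasDerivAt g g' p) (hp : g p = 0) (hg' : g' ≠ 0) :
    Tendsto (fun u => (u - p) * (N u / g u)) (𝓝[≠] p) (𝓝 (N p / g')) := by
  have h1 := hasDerivAt_iff_tendsto_slope.1 hg
  have h2 := (hN.tendsto.mono_left nhdsWithin_le_nhds).div h1 hg'
  refine h2.congr fun u => ?_
  simp only [Pi.div_apply, slope_def_field, hp, sub_zero]
  rw [div_div_eq_mul_div]
  ring

/-! ### Integration against the discontinuous factor $\mu$. -/

lemma intervalIntegral_mul_muFun_vertical {F : ℂ → ℂ} {x a : ℝ} (ha : 0 < a)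
    (hF : IntervalIntegrable (fun y : ℝ => F (x + y * Complex.I)) MeasureTheory.volume (-a) a) :
    IntervalIntegrable (fun y : ℝ => F (x + y * Complex.I) * muFun (x + y * Complex.I))
      MeasureTheory.volume (-a) a ∧
    ∫ y in (-a)..a, F (x + y * Complex.I) * muFun (x + y * Complex.I) =
      1 / 2 * (∫ y in (-a)..0, F (x + y * Complex.I)) -
        1 / 2 * ∫ y in (0 : ℝ)..a, F (x + y * Complex.I) := by
  have h1 : IntervalIntegrable (fun y : ℝ => F (x + y * Complex.I)) MeasureTheory.volume (-a) 0 :=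
    hF.mono_set (by rw [Set.uIcc_of_le (by linarith), Set.uIcc_of_le (by linarith)]
                    exact Set.Icc_subset_Icc_right ha.le)
  have h2 : IntervalIntegrable (fun y : ℝ => F (x + y * Complex.I)) MeasureTheory.volume 0 a :=
    hF.mono_set (by rw [Set.uIcc_of_le (by linarith), Set.uIcc_of_le (by linarith)]
                    exact Set.Icc_subset_Icc_left (by linarith))
  have e1 : Set.EqOn (fun y : ℝ => F (x + y * Complex.I) * (1 / 2))
      (fun y : ℝ => F (x + y * Complex.I) * muFun (x + y * Complex.I)) (Set.Ioo (-a) 0) := by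
    intro y hy
    simp [muFun, hy.2]
  have e2 : Set.EqOn (fun y : ℝ => F (x + y * Complex.I) * (-(1 / 2)))
      (fun y : ℝ => F (x + y * Complex.I) * muFun (x + y * Complex.I)) (Set.Ioo 0 a) := by
    intro y hy
    simp [muFun, hy.1.le]
  have a1 : ∀ᵐ y, y ∈ Set.uIoc (-a) 0 → F (x + y * Complex.I) * (1 / 2) =
      F (x + y * Complex.I) * muFun (x + y * Complex.I) := by
    have : ∀ᵐ y : ℝ, y ≠ 0 := by simp [MeasureTheory.ae_iff]
    filter_upwards [this] with y hy hy'
    rw [Set.uIoc_of_le (by linarith)] at hy'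
    exact e1 ⟨hy'.1, lt_of_le_of_ne hy'.2 hy⟩
  have a2 : ∀ᵐ y, y ∈ Set.uIoc 0 a → F (x + y * Complex.I) * (-(1 / 2)) =
      F (x + y * Complex.I) * muFun (x + y * Complex.I) := by
    have : ∀ᵐ y : ℝ, y ≠ a := by simp [MeasureTheory.ae_iff]
    filter_upwards [this] with y hy hy'
    rw [Set.uIoc_of_le (by linarith)] at hy'
    exact e2 ⟨hy'.1, lt_of_le_of_ne hy'.2 hy⟩
  have i1 := (h1.mul_const (1 / 2)).congr_ae
    ((MeasureTheory.ae_restrict_iff' measurableSet_uIoc).2 a1)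
  have i2 := (h2.mul_const (-(1 / 2))).congr_ae
    ((MeasureTheory.ae_restrict_iff' measurableSet_uIoc).2 a2)
  refine ⟨i1.trans i2, ?_⟩
  rw [← intervalIntegral.integral_add_adjacent_intervals i1 i2,
    ← intervalIntegral.integral_congr_ae a1, ← intervalIntegral.integral_congr_ae a2,
    intervalIntegral.integral_mul_const, intervalIntegral.integral_mul_const]
  ring

/-- Integrating `F μ - P` around a rectangle symmetric about the real axis. -/
lemma rectContourIntegral_mul_muFun_sub {F P : ℂ → ℂ} {x₀ x₁ a : ℝ} (hx : x₀ ≤ x₁) (ha : 0 < a)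
    (hF : ContinuousOn F (rectBoundary x₀ x₁ (-a) a))
    (hP : ContinuousOn P (rectBoundary x₀ x₁ (-a) a)) :
    rectContourIntegral x₀ x₁ a (fun u => F u * muFun u - P u) =
      (∫ x in x₀..x₁, F x) + 1 / 2 * rectIntegral x₀ x₁ (-a) 0 F
        - 1 / 2 * rectIntegral x₀ x₁ 0 a F - rectIntegral x₀ x₁ (-a) a P := by
  have ha' : -a ≤ a := by linarith
  have hb : ∀ x : ℝ, muFun (x + (-a : ℝ) * Complex.I) = 1 / 2 := fun x => by
    simp [muFun, ha]
  have ht : ∀ x : ℝ, muFun (x + a * Complex.I) = -(1 / 2) := fun x => by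
    simp [muFun, ha.le]
  obtain ⟨r1, r2⟩ := intervalIntegral_mul_muFun_vertical ha
    (intervalIntegrable_vertical hx ha' hF (Or.inr rfl))
  obtain ⟨l1, l2⟩ := intervalIntegral_mul_muFun_vertical ha
    (intervalIntegrable_vertical hx ha' hF (Or.inl rfl))
  unfold rectContourIntegral rectIntegral
  simp only [hb, ht]
  rw [intervalIntegral.integral_sub
      ((intervalIntegrable_horizontal hx ha' hF (Or.inl rfl)).mul_const _)
      (intervalIntegrable_horizontal hx ha' hP (Or.inl rfl)),
    intervalIntegral.integral_sub
      ((intervalIntegrable_horizontal hx ha' hF (Or.inr rfl)).mul_const _)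
      (intervalIntegrable_horizontal hx ha' hP (Or.inr rfl)),
    intervalIntegral.integral_sub r1 (intervalIntegrable_vertical hx ha' hP (Or.inr rfl)),
    intervalIntegral.integral_sub l1 (intervalIntegrable_vertical hx ha' hP (Or.inl rfl)),
    r2, l2, intervalIntegral.integral_mul_const, intervalIntegral.integral_mul_const]
  -- The real segment is a side of both half-rectangles and enters with total weight $-1$; the
  -- separate integral of `F` over it cancels this.
  simp only [Complex.ofReal_zero, zero_mul, add_zero]
  ring

/-! ### The principal square root, and the poles of $f$ and of the cotangent. -/

lemma Complex.sqrt_sq' (u : ℂ) : Complex.sqrt u ^ 2 = u :=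
  Complex.cpow_ofNat_inv_pow u 2

lemma Complex.sqrt_of_sq {x : ℂ} (hx : 0 < x.re) : Complex.sqrt (x ^ 2) = x :=
  Complex.sq_cpow_two_inv hx

lemma Complex.sqrt_ne_zero' {u : ℂ} (hu : u ≠ 0) : Complex.sqrt u ≠ 0 := fun h => hu <| by
  rw [← Complex.sqrt_sq' u, h]; simp

lemma Complex.sqrt_ofReal' {x : ℝ} (hx : 0 ≤ x) : Complex.sqrt (x : ℂ) = (Real.sqrt x : ℂ) := by
  rw [Complex.sqrt_of_nonneg (by exact_mod_cast hx), Complex.ofReal_re]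

lemma Complex.hasDerivAt_sqrt' {u : ℂ} (hu : u ∈ Complex.slitPlane) :
    HasDerivAt Complex.sqrt (1 / (2 * Complex.sqrt u)) u := by
  have h0 := Complex.sqrt_ne_zero' (Complex.slitPlane_ne_zero hu)
  have h := (Complex.differentiableAt_sqrt hu).hasDerivAt
  have h2 := h.fun_pow 2
  simp only [Complex.sqrt_sq'] at h2
  have h3 := h2.unique (hasDerivAt_id u)
  refine h.congr_deriv ?_
  push_cast at h3
  rw [eq_div_iff (mul_ne_zero two_ne_zero h0)]
  linear_combination h3

lemma hasDerivAt_exp_two_sqrt_sub_add {T : ℝ} {z u : ℂ} (hu : u ∈ Complex.slitPlane) :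
    HasDerivAt (fun u => Complex.exp (2 * (Complex.sqrt u - T)) + z)
      (Complex.exp (2 * (Complex.sqrt u - T)) / Complex.sqrt u) u := by
  have h := ((((Complex.hasDerivAt_sqrt' hu).sub_const (T : ℂ)).const_mul 2).cexp).add_const z
  have h0 := Complex.sqrt_ne_zero' (Complex.slitPlane_ne_zero hu)
  refine h.congr_deriv ?_
  field_simp

lemma trapIntegrand_eq_div (T : ℝ) (z u : ℂ) : trapIntegrand T z u =
    (z / Real.pi * (1 / Complex.sqrt u) * Complex.exp (Complex.sqrt u - T)) /
      (Complex.exp (2 * (Complex.sqrt u - T)) + z) := by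
  rw [trapIntegrand, mul_div_assoc]

lemma differentiableAt_trapNumerator {T : ℝ} {z u : ℂ} (hu : u ∈ Complex.slitPlane) :
    DifferentiableAt ℂ
      (fun u => z / Real.pi * (1 / Complex.sqrt u) * Complex.exp (Complex.sqrt u - T)) u := by
  have h := Complex.differentiableAt_sqrt hu
  have h0 := Complex.sqrt_ne_zero' (Complex.slitPlane_ne_zero hu)
  fun_prop (disch := assumption)

lemma differentiableAt_trapIntegrand {T : ℝ} {z u : ℂ} (hu : u ∈ Complex.slitPlane)
    (hne : Complex.exp (2 * (Complex.sqrt u - T)) + z ≠ 0) :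
    DifferentiableAt ℂ (trapIntegrand T z) u := by
  rw [funext (trapIntegrand_eq_div T z)]
  exact (differentiableAt_trapNumerator hu).div
    (hasDerivAt_exp_two_sqrt_sub_add hu).differentiableAt hne

open Topology in
/-- The residue of `g f` at a zero of the denominator of `f`. -/
lemma tendsto_sub_mul_trapIntegrand_mul {T : ℝ} {z p : ℂ} {g : ℂ → ℂ} (hg : ContinuousAt g p)
    (hp : p ∈ Complex.slitPlane) (hz : Complex.exp (2 * (Complex.sqrt p - T)) + z = 0) :
    Tendsto (fun u => (u - p) * (trapIntegrand T z u * g u)) (𝓝[≠] p)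
      (𝓝 (-(Complex.exp (Complex.sqrt p - T) / Real.pi) * g p)) := by
  have h0 := Complex.sqrt_ne_zero' (Complex.slitPlane_ne_zero hp)
  have hexp := Complex.exp_ne_zero (2 * (Complex.sqrt p - T))
  have h := tendsto_sub_mul_div (differentiableAt_trapNumerator (T := T) (z := z) hp).continuousAt
    (hasDerivAt_exp_two_sqrt_sub_add hp) hz (div_ne_zero hexp h0)
  have h2 := h.mul (hg.tendsto.mono_left nhdsWithin_le_nhds)
  have hz' : z = -Complex.exp (2 * (Complex.sqrt p - T)) := by linear_combination hz
  have e : z / Real.pi * (1 / Complex.sqrt p) * Complex.exp (Complex.sqrt p - T) /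
      (Complex.exp (2 * (Complex.sqrt p - T)) / Complex.sqrt p) =
      -(Complex.exp (Complex.sqrt p - T) / Real.pi) := by
    rw [hz']
    field_simp
  rw [e] at h2
  refine h2.congr fun u => ?_
  rw [trapIntegrand_eq_div]
  ring

/-- The zeros of the denominator of `f` in a strip. -/
lemma eq_sq_of_exp_two_sqrt_sub_add_eq_zero {T r A ψ : ℝ} {z u : ℂ} (hr : 0 < r)
    (hψ : |ψ| < Real.pi) (hz : z = r * Complex.exp (Complex.I * ψ))
    (hA : A = T + 1 / 2 * Real.log r) (hA0 : 0 < A)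
    (h : Complex.exp (2 * (Complex.sqrt u - T)) + z = 0) (hu : |u.im| ≤ 2 * Real.pi * A) :
    u = (A + ((ψ + Real.pi) / 2 : ℝ) * Complex.I) ^ 2 ∨
      u = (A + ((ψ - Real.pi) / 2 : ℝ) * Complex.I) ^ 2 := by
  have h1 : Complex.exp (2 * (Complex.sqrt u - T)) =
      Complex.exp (Real.log r + Complex.I * ψ + Real.pi * Complex.I) := by
    rw [Complex.exp_add, Complex.exp_add, ← Complex.ofReal_exp, Real.exp_log hr,
      Complex.exp_pi_mul_I, ← hz]
    linear_combination h
  obtain ⟨k, hk⟩ := Complex.exp_eq_exp_iff_exists_int.1 h1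
  have h2 : Complex.sqrt u = A + ((ψ + Real.pi + k * (2 * Real.pi)) / 2 : ℝ) * Complex.I := by
    rw [hA]
    push_cast
    linear_combination hk / 2
  have h3 := Complex.sqrt_sq' u
  rw [h2] at h3
  have h4 : u.im = A * (ψ + Real.pi + k * (2 * Real.pi)) := by
    rw [← h3]
    simp [sq]
    ring
  rw [h4, abs_mul, abs_of_pos hA0] at hu
  -- The half-height $2\pi A$ of the strip forces $|2\operatorname{Im}\sqrt u|\le 2\pi$; as
  -- $\psi+\pi\in(0,2\pi)$, only two values of `k` survive.
  have h5 : |ψ + Real.pi + k * (2 * Real.pi)| ≤ 2 * Real.pi := by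
    nlinarith
  have hpi := Real.pi_pos
  rw [abs_le] at h5
  rw [abs_lt] at hψ
  have k1 : (k : ℝ) < 1 := by nlinarith
  have k2 : (-2 : ℝ) < k := by nlinarith
  have k1' : k < 1 := by exact_mod_cast k1
  have k2' : -2 < k := by exact_mod_cast k2
  have : k = 0 ∨ k = -1 := by omega
  rcases this with rfl | rfl
  · left
    rw [← h3]
    simp
  · right
    rw [← h3]
    push_cast
    ring

lemma exp_two_sqrt_sub_add_eq_zero {T r A η : ℝ} {z : ℂ} (hr : 0 < r)
    (hz : z = -(r * Complex.exp (2 * (η * Complex.I))))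
    (hA : A = T + 1 / 2 * Real.log r) (hA0 : 0 < A) :
    Complex.exp (2 * (Complex.sqrt ((A + η * Complex.I) ^ 2) - T)) + z = 0 := by
  rw [Complex.sqrt_of_sq (by simpa using hA0), hz, hA]
  push_cast
  rw [show 2 * ((T : ℂ) + 1 / 2 * (Real.log r : ℂ) + η * Complex.I - T) =
    Real.log r + 2 * (η * Complex.I) by ring, Complex.exp_add, ← Complex.ofReal_exp,
    Real.exp_log hr]
  ring

lemma sin_pi_mul_div_eq_zero_iff {h : ℝ} (hh : 0 < h) {u : ℂ} :
    Complex.sin (Real.pi * u / h) = 0 ↔ ∃ k : ℤ, u = k * h := by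
  have hpi : (Real.pi : ℂ) ≠ 0 := by exact_mod_cast Real.pi_ne_zero
  have hh' : (h : ℂ) ≠ 0 := by exact_mod_cast hh.ne'
  rw [Complex.sin_eq_zero_iff]
  refine exists_congr fun k => ?_
  rw [div_eq_iff hh']
  constructor
  · intro e
    apply mul_left_cancel₀ hpi
    linear_combination e
  · rintro rfl
    ring

lemma mFun_eq_div (h : ℝ) (u : ℂ) : mFun h u =
    (-(Complex.I / 2) * Complex.cos (Real.pi * u / h)) / Complex.sin (Real.pi * u / h) := by
  rw [mFun, Complex.cot_eq_cos_div_sin]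
  ring

lemma differentiableAt_mFun {h : ℝ} {u : ℂ} (hs : Complex.sin (Real.pi * u / h) ≠ 0) :
    DifferentiableAt ℂ (mFun h) u := by
  rw [funext (mFun_eq_div h)]
  fun_prop (disch := assumption)

-- At a node the factor multiplying $g(p)$ is such that $2\pi i\cdot(-\tfrac i2)\tfrac h\pi=h$:
-- residues of $g\,m$ sum to the trapezoidal rule for $g$.
open Topology in
lemma tendsto_sub_mul_mul_mFun {h : ℝ} (hh : 0 < h) {p : ℂ} {g : ℂ → ℂ} (hg : ContinuousAt g p)
    (hs : Complex.sin (Real.pi * p / h) = 0) :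
    Tendsto (fun u => (u - p) * (g u * mFun h u)) (𝓝[≠] p)
      (𝓝 (g p * (-(Complex.I / 2) * (h / Real.pi)))) := by
  have hpi : (Real.pi : ℂ) ≠ 0 := by exact_mod_cast Real.pi_ne_zero
  have hh' : (h : ℂ) ≠ 0 := by exact_mod_cast hh.ne'
  have hc : Complex.cos (Real.pi * p / h) ≠ 0 := fun hc => by
    have := Complex.sin_sq_add_cos_sq (Real.pi * p / h)
    simp [hc, hs] at this
  have hd : HasDerivAt (fun u : ℂ => Complex.sin (Real.pi * u / h))
      (Complex.cos (Real.pi * p / h) * (Real.pi / h)) p := by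
    have := (((hasDerivAt_id p).const_mul (Real.pi : ℂ)).div_const (h : ℂ)).csin
    simpa using this
  have h1 := tendsto_sub_mul_div
    (N := fun u : ℂ => -(Complex.I / 2) * Complex.cos (Real.pi * u / h))
    (by fun_prop) hd hs (mul_ne_zero hc (div_ne_zero hpi hh'))
  have h2 := (hg.tendsto.mono_left nhdsWithin_le_nhds).mul h1
  have e : -(Complex.I / 2) * Complex.cos (Real.pi * p / h) /
      (Complex.cos (Real.pi * p / h) * (Real.pi / h)) = -(Complex.I / 2) * (h / Real.pi) := by
    field_simp
  rw [e] at h2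
  refine h2.congr fun u => ?_
  rw [mFun_eq_div]
  ring

/-! ### The exact error formula of the trapezoidal rule. -/

/-- The trapezoidal sum equals the integral, a contour integral and two pole contributions. -/
theorem trapezoid_sum_eq {T r A ψ h x₀ x₁ : ℝ} {n : ℕ} {z p q : ℂ} (hr : 0 < r)
    (hψ : |ψ| < Real.pi) (hz : z = r * Complex.exp (Complex.I * ψ))
    (hA : A = T + 1 / 2 * Real.log r) (hA0 : 0 < A) (hh : 0 < h) (hx₀ : 0 < x₀) (hx₀h : x₀ < h)
    (hx₁ : x₁ = n * h + x₀)
    (hp : p = (A + ((ψ + Real.pi) / 2 : ℝ) * Complex.I) ^ 2)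
    (hq : q = (A + ((ψ - Real.pi) / 2 : ℝ) * Complex.I) ^ 2)
    (hpre : p.re ∈ Set.Ioo x₀ x₁) (hqre : q.re ∈ Set.Ioo x₀ x₁) :
    h * ∑ j ∈ Finset.Icc 1 n, trapIntegrand T z (j * h) =
      (∫ x in x₀..x₁, trapIntegrand T z x)
        - rectContourIntegral x₀ x₁ (2 * Real.pi * A) (fun u => trapIntegrand T z u * deltaFun h u)
        - 2 * Complex.I * (Complex.exp (Complex.sqrt p - T) * deltaFun h p +
            Complex.exp (Complex.sqrt q - T) * deltaFun h q) := by
  classical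
  have hpi := Real.pi_pos
  have hpi' : (Real.pi : ℂ) ≠ 0 := by exact_mod_cast Real.pi_ne_zero
  have hψ' := abs_lt.1 hψ
  set a := 2 * Real.pi * A with ha
  have ha0 : 0 < a := by positivity
  have hx : x₀ < x₁ := hpre.1.trans hpre.2
  have hpim : p.im = A * (ψ + Real.pi) := by rw [hp]; simp [sq]; ring
  have hqim : q.im = A * (ψ - Real.pi) := by rw [hq]; simp [sq]; ring
  have hpim0 : 0 < p.im := by rw [hpim]; exact mul_pos hA0 (by linarith)
  have hqim0 : q.im < 0 := by rw [hqim]; exact mul_neg_of_pos_of_neg hA0 (by linarith)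
  have hpima : p.im < a := by rw [hpim]; nlinarith
  have hqima : -a < q.im := by rw [hqim]; nlinarith
  have hexp : ∀ s : ℝ, (s = 1 ∨ s = -1) →
      z = -(r * Complex.exp (2 * (((ψ + s * Real.pi) / 2 : ℝ) * Complex.I))) := by
    intro s hs
    rw [hz]
    have : Complex.exp (2 * (((ψ + s * Real.pi) / 2 : ℝ) * Complex.I)) =
        -Complex.exp (Complex.I * ψ) := by
      have e : (2 * (((ψ + s * Real.pi) / 2 : ℝ) * Complex.I) : ℂ) =
        Complex.I * ψ + s * (Real.pi * Complex.I) := by push_cast; ring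
      rw [e, Complex.exp_add]
      rcases hs with rfl | rfl
      · simp [Complex.exp_pi_mul_I]
      · simp [Complex.exp_neg, Complex.exp_pi_mul_I]
    rw [this]; ring
  have hp0 : Complex.exp (2 * (Complex.sqrt p - T)) + z = 0 := by
    rw [hp]
    refine exp_two_sqrt_sub_add_eq_zero hr ?_ hA hA0
    simpa using hexp 1 (Or.inl rfl)
  have hq0 : Complex.exp (2 * (Complex.sqrt q - T)) + z = 0 := by
    rw [hq]
    refine exp_two_sqrt_sub_add_eq_zero hr ?_ hA hA0
    simpa [sub_eq_add_neg] using hexp (-1) (Or.inr rfl)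
  have hslit : ∀ u : ℂ, x₀ ≤ u.re → u ∈ Complex.slitPlane := fun u hu =>
    Complex.mem_slitPlane_iff.2 (Or.inl (hx₀.trans_le hu))
  have hfd : ∀ u : ℂ, x₀ ≤ u.re → |u.im| ≤ a → u ≠ p → u ≠ q →
      DifferentiableAt ℂ (trapIntegrand T z) u := fun u h1 h2 h3 h4 =>
    differentiableAt_trapIntegrand (hslit u h1) fun h0 => by
      rcases eq_sq_of_exp_two_sqrt_sub_add_eq_zero hr hψ hz hA hA0 h0 h2 with e | e
      · exact h3 (e.trans hp.symm)
      · exact h4 (e.trans hq.symm)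
  set S : Finset ℂ := (Finset.Icc 1 n).image (fun j : ℕ => (j * h : ℂ)) with hS
  have hSim : ∀ u ∈ S, u.im = 0 := by
    intro u hu
    obtain ⟨j, _, rfl⟩ := Finset.mem_image.1 hu
    simp
  have hSre : ∀ u ∈ S, x₀ < u.re ∧ u.re < x₁ := by
    intro u hu
    obtain ⟨j, hj, rfl⟩ := Finset.mem_image.1 hu
    obtain ⟨h1, h2⟩ := Finset.mem_Icc.1 hj
    have h1' : (1 : ℝ) ≤ j := by exact_mod_cast h1
    have h2' : (j : ℝ) ≤ n := by exact_mod_cast h2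
    simp only [Complex.mul_re, Complex.natCast_re, Complex.ofReal_re, Complex.natCast_im,
      Complex.ofReal_im, mul_zero, sub_zero]
    constructor <;> nlinarith
  have hSsin : ∀ u ∈ S, Complex.sin (Real.pi * u / h) = 0 := by
    intro u hu
    obtain ⟨j, _, rfl⟩ := Finset.mem_image.1 hu
    exact (sin_pi_mul_div_eq_zero_iff hh).2 ⟨j, by simp⟩
  have hsinS : ∀ u : ℂ, x₀ ≤ u.re → u.re ≤ x₁ → Complex.sin (Real.pi * u / h) = 0 → u ∈ S := by
    intro u h1 h2 h3
    obtain ⟨k, rfl⟩ := (sin_pi_mul_div_eq_zero_iff hh).1 h3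
    simp only [Complex.mul_re, Complex.intCast_re, Complex.ofReal_re, Complex.intCast_im,
      Complex.ofReal_im, mul_zero, sub_zero] at h1 h2
    have k0 : (0 : ℝ) < k := by
      by_contra! hk
      nlinarith
    -- Here $x_0<h$ matters: $kh\le nh+x_0<(n+1)h$, so the contour encloses no further node.
    have k1 : (k : ℝ) < n + 1 := by nlinarith
    have k0' : 0 < k := by exact_mod_cast k0
    have k1' : k < n + 1 := by exact_mod_cast k1
    lift k to ℕ using k0'.le
    exact Finset.mem_image.2 ⟨k, Finset.mem_Icc.2 ⟨by omega, by omega⟩, by simp⟩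
  have hpS : p ∉ S := fun hm => hpim0.ne' (hSim p hm)
  have hqS : q ∉ S := fun hm => hqim0.ne (hSim q hm)
  have hpq : p ≠ q := fun e => by rw [e] at hpim0; linarith
  -- the full rectangle
  have main : rectIntegral x₀ x₁ (-a) a (fun u => trapIntegrand T z u * mFun h u) =
      2 * Real.pi * Complex.I * ∑ u ∈ insert p (insert q S),
        (if u.im = 0 then trapIntegrand T z u * (-(Complex.I / 2) * (h / Real.pi))
          else -(Complex.exp (Complex.sqrt u - T) / Real.pi) * mFun h u) := by
    refine rectIntegral_eq_sum_residues hx.le (by linarith) _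
      (fun u => if u.im = 0 then trapIntegrand T z u * (-(Complex.I / 2) * (h / Real.pi))
          else -(Complex.exp (Complex.sqrt u - T) / Real.pi) * mFun h u) ?_ _ ?_ ?_
    · intro u hu
      rcases Finset.mem_insert.1 hu with rfl | hu
      · exact ⟨hpre, by linarith, hpima⟩
      rcases Finset.mem_insert.1 hu with rfl | hu
      · exact ⟨hqre, hqima, by linarith⟩
      · exact ⟨hSre u hu, by rw [hSim u hu]; linarith, by rw [hSim u hu]; linarith⟩
    · intro u hu
      have hmem : u ∉ insert p (insert q S) := hu.2
      simp only [Finset.mem_insert, not_or] at hmem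
      have hR := hu.1
      refine ((hfd u hR.1.1 (abs_le.2 hR.2) hmem.1 hmem.2.1).mul
        (differentiableAt_mFun fun h0 => hmem.2.2 ?_)).differentiableWithinAt
      exact hsinS u hR.1.1 hR.1.2 h0
    · intro u hu
      rcases Finset.mem_insert.1 hu with rfl | hu
      · rw [if_neg hpim0.ne']
        exact tendsto_sub_mul_trapIntegrand_mul
          (differentiableAt_mFun fun h0 => hpS (hsinS u hpre.1.le hpre.2.le h0)).continuousAt
          (hslit u hpre.1.le) hp0
      rcases Finset.mem_insert.1 hu with rfl | hu
      · rw [if_neg hqim0.ne]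
        exact tendsto_sub_mul_trapIntegrand_mul
          (differentiableAt_mFun fun h0 => hqS (hsinS u hqre.1.le hqre.2.le h0)).continuousAt
          (hslit u hqre.1.le) hq0
      · rw [if_pos (hSim u hu)]
        refine tendsto_sub_mul_mul_mFun hh (hfd u (hSre u hu).1.le ?_ ?_ ?_).continuousAt
          (hSsin u hu)
        · rw [hSim u hu, abs_zero]; exact ha0.le
        · exact fun e => hpS (e ▸ hu)
        · exact fun e => hqS (e ▸ hu)
  have hsum : ∑ u ∈ S, (if u.im = 0 then trapIntegrand T z u * (-(Complex.I / 2) * (h / Real.pi))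
          else -(Complex.exp (Complex.sqrt u - T) / Real.pi) * mFun h u) =
      (∑ j ∈ Finset.Icc 1 n, trapIntegrand T z (j * h)) *
        (-(Complex.I / 2) * (h / Real.pi)) := by
    rw [hS, Finset.sum_image, Finset.sum_mul]
    · refine Finset.sum_congr rfl fun j _ => ?_
      rw [if_pos (by simp)]
    · intro i _ j _ hij
      have hh' : (h : ℂ) ≠ 0 := by exact_mod_cast hh.ne'
      exact_mod_cast mul_right_cancel₀ hh' hij
  rw [Finset.sum_insert (by simp [hpq, hpS]), Finset.sum_insert hqS, hsum, if_neg hpim0.ne',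
    if_neg hqim0.ne] at main
  -- the two halves
  have upper : rectIntegral x₀ x₁ 0 a (trapIntegrand T z) =
      2 * Real.pi * Complex.I * ∑ u ∈ {p}, -(Complex.exp (Complex.sqrt u - T) / Real.pi) := by
    refine rectIntegral_eq_sum_residues hx.le ha0.le _
      (fun u => -(Complex.exp (Complex.sqrt u - T) / Real.pi)) ?_ _ ?_ ?_
    · simp only [Finset.mem_singleton, forall_eq]
      exact ⟨hpre, hpim0, hpima⟩
    · intro u hu
      have hup : u ≠ p := fun e => hu.2 (by simp [e])
      have hR := hu.1
      refine (hfd u hR.1.1 (abs_le.2 ⟨by linarith [hR.2.1], hR.2.2⟩) hup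
        fun e => ?_).differentiableWithinAt
      have := hR.2.1
      rw [e] at this
      linarith
    · simp only [Finset.mem_singleton, forall_eq]
      simpa using tendsto_sub_mul_trapIntegrand_mul (g := fun _ => 1) continuousAt_const
        (hslit p hpre.1.le) hp0
  have lower : rectIntegral x₀ x₁ (-a) 0 (trapIntegrand T z) =
      2 * Real.pi * Complex.I * ∑ u ∈ {q}, -(Complex.exp (Complex.sqrt u - T) / Real.pi) := by
    refine rectIntegral_eq_sum_residues hx.le (by linarith) _
      (fun u => -(Complex.exp (Complex.sqrt u - T) / Real.pi)) ?_ _ ?_ ?_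
    · simp only [Finset.mem_singleton, forall_eq]
      exact ⟨hqre, hqima, hqim0⟩
    · intro u hu
      have hup : u ≠ q := fun e => hu.2 (by simp [e])
      have hR := hu.1
      refine (hfd u hR.1.1 (abs_le.2 ⟨hR.2.1, by linarith [hR.2.2]⟩)
        (fun e => ?_) hup).differentiableWithinAt
      have := hR.2.2
      rw [e] at this
      linarith
    · simp only [Finset.mem_singleton, forall_eq]
      simpa using tendsto_sub_mul_trapIntegrand_mul (g := fun _ => 1) continuousAt_const
        (hslit q hqre.1.le) hq0
  rw [Finset.sum_singleton] at upper lower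
  have hbd : ∀ u ∈ rectBoundary x₀ x₁ (-a) a, u ≠ p ∧ u ≠ q ∧ u ∉ S := by
    intro u hu
    refine ⟨?_, ?_, fun hm => ?_⟩
    · rintro rfl
      rcases hu.2 with e | e | e | e
      · exact hpre.1.ne' e
      · exact hpre.2.ne e
      · linarith
      · linarith
    · rintro rfl
      rcases hu.2 with e | e | e | e
      · exact hqre.1.ne' e
      · exact hqre.2.ne e
      · linarith
      · linarith
    · have e1 := hSre u hm
      have e2 := hSim u hm
      rcases hu.2 with e | e | e | e <;> linarith
  have key := rectContourIntegral_mul_muFun_sub (F := trapIntegrand T z)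
    (P := fun u => trapIntegrand T z u * mFun h u) hx.le ha0
    (fun u hu => (hfd u hu.1.1.1 (abs_le.2 hu.1.2) (hbd u hu).1
      (hbd u hu).2.1).continuousAt.continuousWithinAt)
    (fun u hu => ((hfd u hu.1.1.1 (abs_le.2 hu.1.2) (hbd u hu).1 (hbd u hu).2.1).mul
      (differentiableAt_mFun fun h0 => (hbd u hu).2.2
        (hsinS u hu.1.1.1 hu.1.1.2 h0))).continuousAt.continuousWithinAt)
  have hfun : (fun u => trapIntegrand T z u * deltaFun h u) =
      fun u => trapIntegrand T z u * muFun u - trapIntegrand T z u * mFun h u := by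
    funext u
    rw [deltaFun]; ring
  -- The weights $\mp\tfrac12$ of the upper and lower halves are $\mu(p)$ and $\mu(q)$; with the
  -- residues of $f\,m$ they combine to $\delta=\mu-m$ at each pole.
  have hmup : muFun p = -(1 / 2) := if_pos hpim0.le
  have hmuq : muFun q = 1 / 2 := if_neg (not_le.2 hqim0)
  rw [hfun, key, upper, lower, main, deltaFun, deltaFun, hmup, hmuq]
  have hI : Complex.I ^ 2 = -1 := Complex.I_sq
  generalize ∑ j ∈ Finset.Icc 1 n, trapIntegrand T z (j * h) = s
  field_simp
  linear_combination h * s * hI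

/-! ### Exponential decay of $\delta$ away from the real axis. -/

lemma deltaFun_neg {h : ℝ} {u : ℂ} (hu : 0 < u.im) : deltaFun h (-u) = -deltaFun h u := by
  have h1 : muFun u = -(1 / 2) := if_pos hu.le
  have h2 : muFun (-u) = 1 / 2 := if_neg (by simpa using hu)
  have h3 : Complex.cot (Real.pi * -u / h) = -Complex.cot (Real.pi * u / h) := by
    rw [show (Real.pi * -u / h : ℂ) = -(Real.pi * u / h) by ring, Complex.cot, Complex.cot,
      Complex.cos_neg, Complex.sin_neg, div_neg]
  rw [deltaFun, deltaFun, mFun, mFun, h1, h2, h3]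
  ring

/-- With $E=e^{2\pi iu/h}$ one has $\delta=E/(1-E)$ in the upper half-plane. The condition $A\ge1$
gives $|E|\le\tfrac12$, hence the factor $2$. -/
lemma norm_deltaFun_le_of_im_pos {h A : ℝ} (hh : 0 < h) (hA : 1 ≤ A) {u : ℂ}
    (hu : A ≤ 2 * Real.pi * u.im / h) : ‖deltaFun h u‖ ≤ 2 * Real.exp (-A) := by
  have hpi := Real.pi_pos
  have him : 0 < u.im := by
    by_contra! hc
    have : 2 * Real.pi * u.im / h ≤ 0 :=
      div_nonpos_of_nonpos_of_nonneg (by nlinarith) hh.le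
    linarith
  have h1 : muFun u = -(1 / 2) := if_pos him.le
  set E := Complex.exp (2 * Complex.I * (Real.pi * u / h)) with hE
  have hEn : ‖E‖ ≤ Real.exp (-A) := by
    rw [hE, Complex.norm_exp]
    apply Real.exp_le_exp.2
    have : (2 * Complex.I * (Real.pi * u / h)).re = -(2 * Real.pi * u.im / h) := by
      rw [show 2 * Complex.I * (Real.pi * u / h) = ((2 * Real.pi / h : ℝ) : ℂ) * (Complex.I * u) by
        push_cast; ring, Complex.re_ofReal_mul]
      simp
      ring
    rw [this]
    linarith
  have hE2 : Real.exp (-A) ≤ 1 / 2 := by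
    have h2 : Real.exp (-A) ≤ Real.exp (-1) := Real.exp_le_exp.2 (by linarith)
    have h3 := Real.exp_neg_one_lt_half
    linarith
  have hE1 : (1 - E) ≠ 0 := fun h0 => by
    have : E = 1 := by linear_combination -h0
    rw [this, norm_one] at hEn
    linarith
  have hd : deltaFun h u = E / (1 - E) := by
    rw [deltaFun, mFun, h1, Complex.cot_eq_exp_ratio, ← hE]
    field_simp
    ring
  have hlow : 1 / 2 ≤ ‖1 - E‖ := by
    have := norm_sub_norm_le (1 : ℂ) E
    rw [norm_one] at this
    linarith
  rw [hd, norm_div, div_le_iff₀ (by linarith)]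
  nlinarith [norm_nonneg E, Real.exp_pos (-A)]

lemma norm_deltaFun_le {h A : ℝ} (hh : 0 < h) (hA : 1 ≤ A) {u : ℂ}
    (hu : A ≤ 2 * Real.pi * |u.im| / h) : ‖deltaFun h u‖ ≤ 2 * Real.exp (-A) := by
  rcases le_or_gt 0 u.im with h0 | h0
  · rw [abs_of_nonneg h0] at hu
    exact norm_deltaFun_le_of_im_pos hh hA hu
  · rw [abs_of_neg h0] at hu
    have h1 := deltaFun_neg (h := h) (u := -u) (by simpa using h0)
    rw [neg_neg] at h1
    rw [h1, norm_neg]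
    exact norm_deltaFun_le_of_im_pos hh hA (by simpa using hu)

/-! ### The truncated integral as an approximation of $\sqrt z$. -/

/-- Adding a nonnegative number to a point on a ray that avoids the negative axis. -/
lemma cos_half_mul_le_norm_add {φ ψ r s : ℝ} (hφ0 : 0 ≤ φ) (hφ : φ < Real.pi) (hψ : |ψ| = φ)
    {z : ℂ} (hz : z = r * Complex.exp (Complex.I * ψ)) :
    Real.cos (φ / 2) * (s + r) ≤ ‖(s : ℂ) + z‖ := by
  have hc : 0 ≤ Real.cos (φ / 2) := Real.cos_nonneg_of_mem_Icc ⟨by linarith, by linarith⟩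
  have hcos : Real.cos ψ = 2 * Real.cos (φ / 2) ^ 2 - 1 := by
    rw [← Real.cos_abs, hψ, ← Real.cos_two_mul]
    congr 1; ring
  have hn : ‖(s : ℂ) + z‖ ^ 2 = s ^ 2 + 2 * s * r * Real.cos ψ + r ^ 2 := by
    rw [hz, mul_comm Complex.I, Complex.exp_mul_I, ← Complex.ofReal_cos, ← Complex.ofReal_sin,
      ← Complex.normSq_eq_norm_sq, Complex.normSq_apply]
    simp only [Complex.add_re, Complex.add_im, Complex.mul_re, Complex.mul_im, Complex.ofReal_re,
      Complex.ofReal_im, Complex.I_re, Complex.I_im]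
    linear_combination r ^ 2 * Real.sin_sq_add_cos_sq ψ
  refine abs_le_of_sq_le_sq' ?_ (norm_nonneg _) |>.2
  rw [hn, hcos, mul_pow]
  have : Real.cos (φ / 2) ^ 2 ≤ 1 := Real.cos_sq_le_one _
  -- The difference of the two sides is exactly $(1-\cos^2\tfrac\varphi2)(s-r)^2$.
  nlinarith [mul_nonneg (sq_nonneg (s - r)) (sub_nonneg.2 this)]

lemma Complex.log_ofReal_mul_I_mul {t : ℝ} (ht : 0 < t) {x : ℂ} (hx : 0 < x.re) :
    Complex.log (t * (Complex.I * x)) = Real.log t + Real.pi / 2 * Complex.I + Complex.log x := by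
  have hx0 : x ≠ 0 := fun h => by simp [h] at hx
  rw [Complex.log_ofReal_mul ht (mul_ne_zero Complex.I_ne_zero hx0), Complex.log_mul
    Complex.I_ne_zero hx0, Complex.log_I]
  · ring
  · have := abs_lt.1 (Complex.abs_arg_lt_pi_div_two_iff.2 (Or.inl hx))
    rw [Complex.arg_I]
    constructor <;> linarith

lemma Complex.log_ofReal_mul_neg_I_mul {t : ℝ} (ht : 0 < t) {x : ℂ} (hx : 0 < x.re) :
    Complex.log (t * (-Complex.I * x)) =
      Real.log t - Real.pi / 2 * Complex.I + Complex.log x := by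
  have hx0 : x ≠ 0 := fun h => by simp [h] at hx
  have hI : -Complex.I ≠ 0 := neg_ne_zero.2 Complex.I_ne_zero
  rw [Complex.log_ofReal_mul ht (mul_ne_zero hI hx0), Complex.log_mul
    hI hx0, Complex.log_neg_I]
  · ring
  · have := abs_lt.1 (Complex.abs_arg_lt_pi_div_two_iff.2 (Or.inl hx))
    rw [Complex.arg_neg_I]
    constructor <;> linarith

/-- Up to the factor `2i`, the function `t ↦ arctan (t / w)`. -/
noncomputable def logQuotient (w : ℂ) (t : ℝ) : ℂ :=
  Complex.log (w + t * Complex.I) - Complex.log (w - t * Complex.I)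

lemma hasDerivAt_logQuotient {w : ℂ} (hw : 0 < w.re) (t : ℝ) :
    HasDerivAt (logQuotient w) (2 * Complex.I * w / (t ^ 2 + w ^ 2)) t := by
  have h1 : HasDerivAt (fun t : ℝ => (t * Complex.I : ℂ)) (1 * Complex.I) t :=
    (Complex.ofRealCLM.hasDerivAt (x := t)).mul_const _
  have hp : w + t * Complex.I ∈ Complex.slitPlane :=
    Complex.mem_slitPlane_iff.2 (Or.inl (by simpa using hw))
  have hm : w - t * Complex.I ∈ Complex.slitPlane :=
    Complex.mem_slitPlane_iff.2 (Or.inl (by simpa using hw))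
  have h2 := ((h1.const_add w).clog_real hp).sub ((h1.const_sub w).clog_real hm)
  refine h2.congr_deriv ?_
  have hp0 := Complex.slitPlane_ne_zero hp
  have hm0 := Complex.slitPlane_ne_zero hm
  have e : (t : ℂ) ^ 2 + w ^ 2 = (w + t * Complex.I) * (w - t * Complex.I) := by
    linear_combination (t : ℂ) ^ 2 * Complex.I_sq
  rw [e, div_sub_div _ _ hp0 hm0]
  congr 1
  ring

/-- The derivative is at most $2/(c|w|)$, so the prefactor $w$ removes the blow-up as $w\to0$. This
controls the lower truncation uniformly in $z$. -/
lemma norm_logQuotient_le {w : ℂ} (hw : 0 < w.re) {c t : ℝ} (hc : 0 < c) (ht : 0 ≤ t)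
    (hl : ∀ s : ℝ, c * (s ^ 2 + ‖w‖ ^ 2) ≤ ‖(s : ℂ) ^ 2 + w ^ 2‖) :
    ‖w * logQuotient w t‖ ≤ 2 / c * t := by
  have hw0 : 0 < ‖w‖ := norm_pos_iff.2 fun h => by simp [h] at hw
  have hb : ∀ s ∈ Set.Icc (0 : ℝ) t, ‖2 * Complex.I * w / (s ^ 2 + w ^ 2)‖ ≤ 2 / (c * ‖w‖) := by
    intro s _
    have h1 : c * ‖w‖ ^ 2 ≤ ‖(s : ℂ) ^ 2 + w ^ 2‖ := by nlinarith [hl s, sq_nonneg s]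
    rw [norm_div, norm_mul, norm_mul, Complex.norm_I, Complex.norm_ofNat,
      div_le_div_iff₀ (lt_of_lt_of_le (by positivity) h1) (by positivity)]
    nlinarith
  have h := (convex_Icc (0 : ℝ) t).norm_image_sub_le_of_norm_hasDerivWithin_le
    (fun s _ => (hasDerivAt_logQuotient hw s).hasDerivWithinAt) hb
    (Set.left_mem_Icc.2 ht) (Set.right_mem_Icc.2 ht)
  have h0 : logQuotient w 0 = 0 := by simp [logQuotient]
  rw [h0, sub_zero, sub_zero, Real.norm_of_nonneg ht] at h
  rw [norm_mul]
  calc ‖w‖ * ‖logQuotient w t‖ ≤ ‖w‖ * (2 / (c * ‖w‖) * t) := by gcongr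
    _ = 2 / c * t := by field_simp

/-- Pulling $\pm it$ out of $w\pm it$ leaves $\log(1\mp v)$ with $v=iw/t$, each at most
$\tfrac32|v|$; the logarithms of $\pm i$ supply $\pi i$. -/
lemma norm_logQuotient_sub_le {w : ℂ} {t : ℝ} (ht : 0 < t) (hwt : ‖w‖ ≤ t / 2) :
    ‖logQuotient w t - Real.pi * Complex.I‖ ≤ 3 * (‖w‖ / t) := by
  have ht' : (t : ℂ) ≠ 0 := by exact_mod_cast ht.ne'
  set v : ℂ := Complex.I * (w / t) with hv
  have hvn : ‖v‖ = ‖w‖ / t := by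
    rw [hv, norm_mul, Complex.norm_I, one_mul, norm_div, Complex.norm_real,
      Real.norm_of_nonneg ht.le]
  have hv2 : ‖v‖ ≤ 1 / 2 := by
    rw [hvn, div_le_iff₀ ht]; linarith
  have hre := abs_le.1 ((Complex.abs_re_le_norm v).trans hv2)
  have e1 : w + t * Complex.I = t * (Complex.I * (1 + -v)) := by
    rw [hv]
    field_simp
    linear_combination w * Complex.I_sq
  have e2 : w - t * Complex.I = t * (-Complex.I * (1 + v)) := by
    rw [hv]
    field_simp
    linear_combination w * Complex.I_sq
  have h1 := Complex.norm_log_one_add_half_le_self hv2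
  have h2 := Complex.norm_log_one_add_half_le_self (z := -v) (by rwa [norm_neg])
  rw [norm_neg] at h2
  rw [logQuotient, e1, e2, Complex.log_ofReal_mul_I_mul ht (by simp; linarith [hre.2]),
    Complex.log_ofReal_mul_neg_I_mul ht (by simp; linarith [hre.1])]
  rw [show ∀ a b c d : ℂ, a + b / 2 * Complex.I + c - (a - b / 2 * Complex.I + d) - b * Complex.I
    = c - d from fun a b c d => by ring]
  refine (norm_sub_le _ _).trans ?_
  rw [← hvn]
  linarith

/-- The substitution $t=e^{\sqrt x-T}$ gives $\frac{2w^2}{\pi}\int\frac{dt}{t^2+w^2}$. -/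
lemma integral_trapIntegrand {T x₀ x₁ : ℝ} {w : ℂ} (hx₀ : 0 < x₀) (hx₁ : x₀ ≤ x₁) (hw : 0 < w.re) :
    ∫ x in x₀..x₁, trapIntegrand T (w ^ 2) x =
      w / (Real.pi * Complex.I) * (logQuotient w (Real.exp (Real.sqrt x₁ - T)) -
        logQuotient w (Real.exp (Real.sqrt x₀ - T))) := by
  have hne : ∀ t : ℝ, (t : ℂ) ^ 2 + w ^ 2 ≠ 0 := by
    intro t h0
    have e : (t : ℂ) ^ 2 + w ^ 2 = (w + t * Complex.I) * (w - t * Complex.I) := by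
      linear_combination (t : ℂ) ^ 2 * Complex.I_sq
    rw [e] at h0
    rcases mul_eq_zero.1 h0 with h | h
    · have := congrArg Complex.re h
      simp at this
      linarith
    · have := congrArg Complex.re h
      simp at this
      linarith
  have hpos : ∀ x ∈ Set.uIcc x₀ x₁, 0 < x := fun x hx => by
    rw [Set.uIcc_of_le hx₁] at hx
    exact hx₀.trans_le hx.1
  have hexp : ∀ x : ℝ, 0 < x → Complex.exp (2 * (Complex.sqrt x - T)) =
      ((Real.exp (Real.sqrt x - T) : ℝ) : ℂ) ^ 2 := by
    intro x hx
    rw [Complex.sqrt_ofReal' hx.le, Complex.ofReal_exp, ← Complex.exp_nat_mul]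
    push_cast
    rfl
  have hd : ∀ x ∈ Set.uIcc x₀ x₁, HasDerivAt
      (fun x : ℝ => w / (Real.pi * Complex.I) * logQuotient w (Real.exp (Real.sqrt x - T)))
      (trapIntegrand T (w ^ 2) x) x := by
    intro x hx
    have hx0 := hpos x hx
    have h1 : HasDerivAt (fun x : ℝ => Real.exp (Real.sqrt x - T))
        (Real.exp (Real.sqrt x - T) * (1 / (2 * Real.sqrt x))) x :=
      ((Real.hasDerivAt_sqrt hx0.ne').sub_const T).exp
    have h2 := ((hasDerivAt_logQuotient hw _).scomp x h1).const_mul (w / (Real.pi * Complex.I))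
    refine h2.congr_deriv ?_
    rw [trapIntegrand, hexp x hx0, Complex.sqrt_ofReal' hx0.le]
    have e2 : Complex.exp (Real.sqrt x - T) = (Real.exp (Real.sqrt x - T) : ℝ) := by
      push_cast; rfl
    rw [e2, Complex.real_smul]
    have := hne (Real.exp (Real.sqrt x - T))
    have hs : (Real.sqrt x : ℂ) ≠ 0 := by exact_mod_cast (Real.sqrt_pos.2 hx0).ne'
    have hpi' : (Real.pi : ℂ) ≠ 0 := by exact_mod_cast Real.pi_ne_zero
    have hI := Complex.I_ne_zero
    generalize Real.exp (Real.sqrt x - T) = t at *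
    push_cast
    field_simp
  rw [intervalIntegral.integral_eq_sub_of_hasDerivAt hd]
  · ring
  · refine ContinuousOn.intervalIntegrable fun x hx => ?_
    have hx0 := hpos x hx
    have h1 : DifferentiableAt ℂ (trapIntegrand T (w ^ 2)) x :=
      differentiableAt_trapIntegrand (Complex.mem_slitPlane_iff.2 (Or.inl (by simpa using hx0)))
        (by rw [hexp x hx0]; exact hne _)
    exact (ContinuousAt.comp (f := fun x : ℝ => (x : ℂ)) h1.continuousAt
      Complex.continuous_ofReal.continuousAt).continuousWithinAt

/-- The truncated integral of `f(·, z)` is close to `√z`. -/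
lemma norm_integral_trapIntegrand_sub_le {T x₀ x₁ c : ℝ} {w : ℂ} (hx₀ : 0 < x₀) (hx₀1 : x₀ ≤ 1)
    (hx₁ : 4 * T ^ 2 ≤ x₁) (hT : 1 ≤ T) (hw : 0 < w.re) (hw1 : ‖w‖ ≤ 1) (hc : 0 < c)
    (hl : ∀ s : ℝ, c * (s ^ 2 + ‖w‖ ^ 2) ≤ ‖(s : ℂ) ^ 2 + w ^ 2‖) :
    ‖(∫ x in x₀..x₁, trapIntegrand T (w ^ 2) x) - w‖ ≤ (3 + 6 / c) * Real.exp (-T) := by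
  have hpi := Real.pi_gt_three
  have hpi' : (Real.pi : ℂ) ≠ 0 := by exact_mod_cast Real.pi_ne_zero
  rw [integral_trapIntegrand hx₀ (by nlinarith) hw]
  set t₀ := Real.exp (Real.sqrt x₀ - T)
  set t₁ := Real.exp (Real.sqrt x₁ - T)
  have ht₀ : t₀ ≤ 3 * Real.exp (-T) := by
    have h1 : Real.sqrt x₀ ≤ 1 := Real.sqrt_le_one.2 hx₀1
    have h2 : t₀ ≤ Real.exp (1 + -T) := Real.exp_le_exp.2 (by linarith)
    rw [Real.exp_add] at h2
    nlinarith [Real.exp_one_lt_three, Real.exp_pos (-T)]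
  -- Since $\sqrt{x_1}\ge2T$, the upper cut-off is at least $e^T$, matching the lower one of order
  -- $e^{-T}$: both truncations cost $O(e^{-T})$.
  have ht₁ : Real.exp T ≤ t₁ := by
    apply Real.exp_le_exp.2
    have : 2 * T ≤ Real.sqrt x₁ := Real.le_sqrt_of_sq_le (by nlinarith)
    linarith
  have ht₁' : 0 < t₁ := Real.exp_pos _
  have h2 : 2 ≤ t₁ := by
    have := Real.add_one_le_exp T
    linarith
  have b1 := norm_logQuotient_le hw hc (Real.exp_pos (Real.sqrt x₀ - T)).le hl
  have b2 := norm_logQuotient_sub_le (w := w) ht₁' (by linarith)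
  have hinv : ‖w‖ / t₁ ≤ Real.exp (-T) := by
    rw [div_le_iff₀ ht₁']
    have : Real.exp (-T) * Real.exp T = 1 := by rw [← Real.exp_add]; simp
    nlinarith [Real.exp_pos (-T)]
  have e : w / (Real.pi * Complex.I) * (logQuotient w t₁ - logQuotient w t₀) - w =
      1 / (Real.pi * Complex.I) *
        (w * (logQuotient w t₁ - Real.pi * Complex.I) - w * logQuotient w t₀) := by
    have := Complex.I_ne_zero
    field_simp
    ring
  rw [e, norm_mul]
  have hn : ‖1 / ((Real.pi : ℂ) * Complex.I)‖ ≤ 1 := by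
    rw [norm_div, norm_mul, Complex.norm_I, Complex.norm_real, Real.norm_of_nonneg (by linarith),
      norm_one, mul_one, div_le_one (by linarith)]
    linarith
  have b3 : ‖w * (logQuotient w t₁ - Real.pi * Complex.I)‖ ≤ 3 * Real.exp (-T) := by
    rw [norm_mul]
    calc _ ≤ 1 * (3 * (‖w‖ / t₁)) := by gcongr
      _ ≤ _ := by linarith
  have b4 : ‖w * logQuotient w t₀‖ ≤ 6 / c * Real.exp (-T) := by
    calc _ ≤ 2 / c * t₀ := b1
      _ ≤ 2 / c * (3 * Real.exp (-T)) := by gcongr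
      _ = _ := by ring
  calc _ ≤ 1 * (‖w * (logQuotient w t₁ - Real.pi * Complex.I)‖ + ‖w * logQuotient w t₀‖) := by
        gcongr
        exact norm_sub_le _ _
    _ ≤ _ := by linarith

/-! ### The trapezoidal error on the V-shaped domain. -/

lemma stepSize_pos {β : ℝ} (hβ : β < 2) : 0 < stepSize β :=
  mul_pos (by linarith) (by positivity)

lemma exists_angle_of_mem_vShape {β : ℝ} (hβ₀ : 0 ≤ β) {z : ℂ} (hz : z ∈ vShape β) :
    ∃ r ψ : ℝ, 0 ≤ r ∧ r ≤ 1 ∧ |ψ| = β * Real.pi / 2 ∧ z = r * Complex.exp (Complex.I * ψ) ∧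
      (z = r * Complex.exp (Complex.I * (β * Real.pi / 2)) ∨
      z = r * Complex.exp (-(Complex.I * (β * Real.pi / 2)))) := by
  obtain ⟨r, h0, h1, h⟩ := hz
  have hpos : 0 ≤ β * Real.pi / 2 := by positivity
  rcases h with h | h
  · exact ⟨r, β * Real.pi / 2, h0, h1, abs_of_nonneg hpos, by rw [h]; push_cast; rfl, Or.inl h⟩
  · refine ⟨r, -(β * Real.pi / 2), h0, h1, by rw [abs_neg, abs_of_nonneg hpos], ?_, Or.inr h⟩
    rw [h]
    push_cast
    rw [mul_neg]

/-- As $\pi/4<0.8$, $|\eta|\le0.8A$, so the real part $A^2-\eta^2$ is at least $0.36A^2\ge1.44$. The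
requirement $A\ge2+\beta$ is the threshold $r\ge e^{4+2\beta-2T}$. -/
lemma pole_re_mem {A η T β x₀ x₁ : ℝ} (hβ₀ : 0 ≤ β) (hA : 2 + β ≤ A) (hAT : A ≤ T)
    (hη : |η| ≤ Real.pi * (2 + β) / 4) (hx₀ : x₀ ≤ 1) (hx₁ : 4 * T ^ 2 < x₁) :
    ((A + η * Complex.I) ^ 2 : ℂ).re ∈ Set.Ioo x₀ x₁ := by
  have hre : ((A + η * Complex.I) ^ 2 : ℂ).re = A ^ 2 - η ^ 2 := by simp [sq]
  rw [hre]
  have hpi := Real.pi_gt_three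
  have hpi' := Real.pi_lt_d2
  have h1 : |η| ≤ 0.8 * A := by nlinarith
  have h2 : η ^ 2 ≤ (0.8 * A) ^ 2 := sq_le_sq' (by linarith [neg_abs_le η]) (by
    linarith [le_abs_self η])
  constructor <;> nlinarith

/-- From $\operatorname{Im}p=2A\eta$ and $h=(2-\beta)\pi^2$ one gets $2\pi|\operatorname{Im}p|/h\ge
A$, with equality for the smallest $|\eta|$. The exponential has modulus $\sqrt r$, and $\sqrt
r\,e^{-A}=e^{-T}$. -/
lemma norm_pole_term_le {T r A η β : ℝ} (hβ₂ : β < 2)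
    (hA : A = T + 1 / 2 * Real.log r) (hA1 : 1 ≤ A) (hη : Real.pi * (2 - β) / 4 ≤ |η|) {p : ℂ}
    (hp : p = (A + η * Complex.I) ^ 2) :
    ‖Complex.exp (Complex.sqrt p - T) * deltaFun (stepSize β) p‖ ≤ 2 * Real.exp (-T) := by
  have hh := stepSize_pos hβ₂
  have hpi := Real.pi_pos
  have him : p.im = 2 * A * η := by rw [hp]; simp [sq]; ring
  have h1 : ‖deltaFun (stepSize β) p‖ ≤ 2 * Real.exp (-A) := by
    refine norm_deltaFun_le hh hA1 ?_
    rw [him, abs_mul, abs_of_pos (by linarith), le_div_iff₀ hh, stepSize]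
    nlinarith [mul_le_mul_of_nonneg_left hη (by positivity : 0 ≤ 4 * Real.pi * A)]
  have h2 : ‖Complex.exp (Complex.sqrt p - T)‖ = Real.exp (1 / 2 * Real.log r) := by
    rw [Complex.norm_exp, hp, Complex.sqrt_of_sq (by simp; linarith), hA]
    simp
  rw [norm_mul, h2]
  calc _ ≤ Real.exp (1 / 2 * Real.log r) * (2 * Real.exp (-A)) := by gcongr
    _ = 2 * (Real.exp (1 / 2 * Real.log r) * Real.exp (-A)) := by ring
    _ = 2 * Real.exp (-T) := by rw [← Real.exp_add, hA]; ring_nf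

lemma cos_quarter_pos {β : ℝ} (hβ₀ : 0 ≤ β) (hβ₂ : β < 2) : 0 < Real.cos (β * Real.pi / 2 / 2) := by
  have hpi := Real.pi_pos
  apply Real.cos_pos_of_mem_Ioo
  constructor <;> nlinarith

lemma sqrt_ray {r ψ : ℝ} (hr : 0 < r) (hψ : |ψ| < Real.pi) :
    ∃ w : ℂ, 0 < w.re ∧ w ^ 2 = r * Complex.exp (Complex.I * ψ) ∧ ‖w‖ = Real.sqrt r := by
  have hψ' := abs_lt.1 hψ
  have hrs := Real.sqrt_pos.2 hr
  refine ⟨Real.sqrt r * Complex.exp ((ψ / 2 : ℝ) * Complex.I), ?_, ?_, ?_⟩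
  · rw [Complex.re_ofReal_mul, Complex.exp_ofReal_mul_I_re]
    exact mul_pos hrs (Real.cos_pos_of_mem_Ioo ⟨by linarith, by linarith⟩)
  · rw [mul_pow, ← Complex.exp_nat_mul, ← Complex.ofReal_pow, Real.sq_sqrt hr.le]
    congr 2
    push_cast
    ring
  · rw [norm_mul, Complex.norm_exp_ofReal_mul_I, Complex.norm_real, mul_one,
      Real.norm_of_nonneg hrs.le]

/-- The trapezoidal rule error away from the tip, given the bound on the contour integral. -/
lemma norm_trapezoid_sub_sqrt_le {β T r ψ C : ℝ} {n : ℕ} {z : ℂ} (hβ₀ : 0 ≤ β) (hβ₂ : β < 2)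
    (hT : T = truncParam (stepSize β) n) (hT1 : 1 ≤ T) (hr : Real.exp (4 + 2 * β - 2 * T) ≤ r)
    (hr1 : r ≤ 1) (hψ : |ψ| = β * Real.pi / 2) (hz : z = r * Complex.exp (Complex.I * ψ))
    (hC : ‖rectContourIntegral (1 - β / 2) (4 * T ^ 2 + 1 - β / 2)
          (2 * Real.pi * (T + 1 / 2 * Real.log r))
          (fun u => trapIntegrand T z u * deltaFun (stepSize β) u)‖ ≤ C * Real.exp (-T)) :
    ‖(stepSize β : ℂ) * ∑ j ∈ Finset.Icc 1 n, trapIntegrand T z (j * stepSize β) - Complex.sqrt z‖ ≤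
      (3 + 6 / Real.cos (β * Real.pi / 2 / 2) + C + 8) * Real.exp (-T) := by
  have hpi := Real.pi_gt_three
  have hh := stepSize_pos hβ₂
  have hr0 : 0 < r := (Real.exp_pos _).trans_le hr
  have hφ : β * Real.pi / 2 < Real.pi := by nlinarith
  have hφ0 : 0 ≤ β * Real.pi / 2 := by positivity
  have hc := cos_quarter_pos hβ₀ hβ₂
  have hψπ : |ψ| < Real.pi := hψ ▸ hφ
  have hlog : 4 + 2 * β - 2 * T ≤ Real.log r := (Real.le_log_iff_exp_le hr0).2 hr
  have hlog1 : Real.log r ≤ 0 := Real.log_nonpos hr0.le hr1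
  set A := T + 1 / 2 * Real.log r with hA
  have hA2 : 2 + β ≤ A := by linarith
  have hAT : A ≤ T := by linarith
  have hT2 : 4 * T ^ 2 = n * stepSize β := by
    rw [hT, truncParam, Real.sq_sqrt (by positivity)]; ring
  have hx₀h : 1 - β / 2 < stepSize β := by
    rw [stepSize]; nlinarith
  have hlow : ∀ s : ℝ, (s = Real.pi ∨ s = -Real.pi) →
      |(ψ + s) / 2| ≤ Real.pi * (2 + β) / 4 ∧ Real.pi * (2 - β) / 4 ≤ |(ψ + s) / 2| := by
    intro s hs
    have hsn : |s| = Real.pi := by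
      rcases hs with rfl | rfl
      · exact abs_of_pos (by linarith)
      · rw [abs_neg]; exact abs_of_pos (by linarith)
    have h1 := abs_add_le ψ s
    have h2 := abs_sub_abs_le_abs_sub s (-ψ)
    rw [sub_neg_eq_add, abs_neg, add_comm s ψ] at h2
    rw [abs_div, abs_two]
    constructor <;> linarith
  obtain ⟨p1, p2⟩ := hlow Real.pi (Or.inl rfl)
  obtain ⟨q1, q2⟩ := hlow (-Real.pi) (Or.inr rfl)
  rw [← sub_eq_add_neg] at q1 q2
  obtain ⟨w, hw, hw2, hwn⟩ := sqrt_ray hr0 hψπ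
  have hwz : w ^ 2 = z := hw2.trans hz.symm
  have key := trapezoid_sum_eq (T := T) (n := n) hr0 hψπ hz hA (by linarith) hh
    (by linarith : 0 < 1 - β / 2) hx₀h
    (by rw [← hT2]; ring : 4 * T ^ 2 + 1 - β / 2 = n * stepSize β + (1 - β / 2)) rfl rfl
    (pole_re_mem hβ₀ hA2 hAT p1 (by linarith) (by linarith))
    (pole_re_mem hβ₀ hA2 hAT q1 (by linarith) (by linarith))
  have hP := norm_pole_term_le hβ₂ hA (by linarith) p2 rfl
  have hQ := norm_pole_term_le hβ₂ hA (by linarith) q2 rfl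
  have hI := norm_integral_trapIntegrand_sub_le (T := T) (x₀ := 1 - β / 2)
    (x₁ := 4 * T ^ 2 + 1 - β / 2) (c := Real.cos (β * Real.pi / 2 / 2)) (w := w) (by linarith)
    (by linarith) (by linarith) hT1 hw (by rw [hwn]; exact Real.sqrt_le_one.2 hr1) hc (by
      intro s
      have := cos_half_mul_le_norm_add (s := s ^ 2) hφ0 hφ hψ hz
      rw [hwn, Real.sq_sqrt hr0.le, hwz]
      exact_mod_cast this)
  rw [hwz] at hI
  have hsq : Complex.sqrt z = w := by rw [← hwz, Complex.sqrt_of_sq hw]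
  rw [key, hsq]
  set I₁ := ∫ x in (1 - β / 2)..(4 * T ^ 2 + 1 - β / 2), trapIntegrand T z x
  rw [show ∀ a b c d : ℂ, a - b - c - d = (a - d) - b - c from fun _ _ _ _ => by ring]
  refine (norm_sub_le _ _).trans ?_
  have h3 := norm_sub_le (I₁ - w) (rectContourIntegral (1 - β / 2) (4 * T ^ 2 + 1 - β / 2)
    (2 * Real.pi * A) (fun u => trapIntegrand T z u * deltaFun (stepSize β) u))
  have h4 : ∀ a b : ℂ, ‖2 * Complex.I * (a + b)‖ ≤ 2 * (‖a‖ + ‖b‖) := fun a b => by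
    rw [norm_mul, norm_mul, Complex.norm_I, Complex.norm_ofNat, mul_one]
    gcongr
    exact norm_add_le a b
  refine (add_le_add h3 (h4 _ _)).trans ?_
  linarith

/-- The weights of the trapezoidal rule. -/
noncomputable def trapWeight (h T : ℝ) (j : ℕ) : ℝ :=
  h / Real.pi * (1 / Real.sqrt (j * h)) * Real.exp (Real.sqrt (j * h) - T)

lemma stepSize_mul_trapIntegrand {h T : ℝ} (hh : 0 < h) (j : ℕ) (z : ℂ) :
    h * trapIntegrand T z (j * h) = trapWeight h T j *
      (z / (z + Real.exp (2 * (Real.sqrt (j * h) - T)))) := by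
  have e : ((j : ℂ) * h) = ((j * h : ℝ) : ℂ) := by push_cast; rfl
  rw [trapIntegrand, trapWeight, e, Complex.sqrt_ofReal' (by positivity)]
  push_cast
  rw [add_comm z]
  ring

lemma trapWeight_nonneg {h T : ℝ} (hh : 0 < h) (j : ℕ) : 0 ≤ trapWeight h T j := by
  have := Real.pi_pos
  unfold trapWeight
  positivity

lemma trapWeight_le {h T : ℝ} (hh : 0 < h) {j : ℕ} (hj : 1 ≤ j) :
    trapWeight h T j ≤ Real.sqrt h * Real.exp (Real.sqrt (j * h) - T) := by
  have hpi := Real.pi_gt_three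
  have hs := Real.sqrt_pos.2 hh
  have hj' : (1 : ℝ) ≤ j := by exact_mod_cast hj
  have h1 : Real.sqrt h ≤ Real.sqrt (j * h) := Real.sqrt_le_sqrt (by nlinarith)
  have h2 : h / Real.pi * (1 / Real.sqrt (j * h)) ≤ Real.sqrt h := by
    rw [div_mul_div_comm, mul_one, div_le_iff₀ (by positivity)]
    have h3 : Real.sqrt h ≤ Real.pi * Real.sqrt (j * h) := by nlinarith
    nlinarith [Real.mul_self_sqrt hh.le, mul_le_mul_of_nonneg_left h3 hs.le]
  unfold trapWeight
  gcongr

/-- The terms of the trapezoidal rule near the tip. -/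
lemma norm_trapWeight_mul_le {β h T r ψ : ℝ} {z : ℂ} (hβ₀ : 0 ≤ β) (hβ₂ : β < 2) (hh : 0 < h)
    (hr0 : 0 ≤ r) (hψ : |ψ| = β * Real.pi / 2) (hz : z = r * Complex.exp (Complex.I * ψ)) {j : ℕ}
    (hj : 1 ≤ j) : ‖(trapWeight h T j : ℂ) *
      (z / (z + Real.exp (2 * (Real.sqrt (j * h) - T))))‖ ≤
      Real.sqrt h / Real.cos (β * Real.pi / 2 / 2) * r * Real.exp (T - Real.sqrt (j * h)) := by
  have hpi := Real.pi_pos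
  have hc := cos_quarter_pos hβ₀ hβ₂
  set c := Real.cos (β * Real.pi / 2 / 2) with hcdef
  set s := Real.sqrt (j * h) - T with hs
  have h1 := cos_half_mul_le_norm_add (s := Real.exp (2 * s)) (by positivity : 0 ≤ β * Real.pi / 2)
    (by nlinarith) hψ hz
  rw [← hcdef, add_comm _ z] at h1
  -- Dropping `c * r` leaves a bound linear in `r`, which is what makes the sum small near the tip.
  have h2 : c * Real.exp (2 * s) ≤ ‖z + (Real.exp (2 * s) : ℂ)‖ := by
    have h0 := mul_nonneg hc.le hr0
    have h3 := h1
    push_cast at h3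
    linarith
  have hzn : ‖z‖ = r := by
    rw [hz, norm_mul, mul_comm Complex.I, Complex.norm_exp_ofReal_mul_I, mul_one, Complex.norm_real,
      Real.norm_of_nonneg hr0]
  have h3 := trapWeight_le (T := T) hh hj
  rw [← hs] at h3
  have hpos : 0 < c * Real.exp (2 * s) := by positivity
  have hw := trapWeight_nonneg (T := T) hh j
  rw [norm_mul, norm_div, hzn, Complex.norm_real, Real.norm_of_nonneg hw]
  calc _ ≤ Real.sqrt h * Real.exp s * (r / (c * Real.exp (2 * s))) := by gcongr
    _ = Real.sqrt h / c * r * (Real.exp s / Real.exp (2 * s)) := by field_simp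
    _ = _ := by
      rw [← Real.exp_sub]
      congr 2
      rw [hs]; ring

/-- With $y=\sqrt{jh}$, $e^y\ge y^4/24=(jh)^2/24$ gives comparison with $\sum j^{-2}$. -/
lemma summable_exp_neg_sqrt {h : ℝ} (hh : 0 < h) :
    Summable fun j : ℕ => Real.exp (-Real.sqrt (j * h)) := by
  have h1 : Summable fun j : ℕ => 24 / h ^ 2 * (1 / (j : ℝ) ^ 2) :=
    (Real.summable_one_div_nat_pow.2 one_lt_two).mul_left _
  refine (summable_nat_add_iff 1).1 (Summable.of_nonneg_of_le (fun _ => (Real.exp_pos _).le) ?_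
    ((summable_nat_add_iff 1).2 h1))
  intro j
  have hj : (0 : ℝ) < ((j + 1 : ℕ) : ℝ) := by positivity
  generalize ((j + 1 : ℕ) : ℝ) = x at hj
  have hx := mul_pos hj hh
  have h2 := Real.pow_div_factorial_le_exp (Real.sqrt (x * h)) (Real.sqrt_nonneg _) 4
  have h3 : Real.sqrt (x * h) ^ 4 = (x * h) ^ 2 := by
    rw [show (4 : ℕ) = 2 * 2 from rfl, pow_mul, Real.sq_sqrt hx.le]
  rw [h3] at h2
  have h4 : (0 : ℝ) < (x * h) ^ 2 / (Nat.factorial 4 : ℕ) := by positivity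
  rw [Real.exp_neg]
  calc _ ≤ ((x * h) ^ 2 / (Nat.factorial 4 : ℕ))⁻¹ := inv_anti₀ h4 h2
    _ = _ := by
      simp only [Nat.factorial]
      push_cast
      field_simp

/-- The trapezoidal rule approximates `√z` on the V-shaped domain. -/
theorem exists_trapezoid_error_bound {β : ℝ} (hβ₀ : 0 ≤ β) (hβ₂ : β < 2)
    (hconj : ContourBoundConjecture β) :
    ∃ C : ℝ, ∀ᶠ n : ℕ in atTop, ∀ z ∈ vShape β,
      ‖∑ j ∈ Finset.Icc 1 n, (trapWeight (stepSize β) (truncParam (stepSize β) n) j : ℂ) *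
        (z / (z + Real.exp (2 * (Real.sqrt (j * stepSize β) - truncParam (stepSize β) n)))) -
          Complex.sqrt z‖ ≤ C * Real.exp (-truncParam (stepSize β) n) := by
  obtain ⟨C, hC⟩ := hconj
  have hh := stepSize_pos hβ₂
  have hc := cos_quarter_pos hβ₀ hβ₂
  set c := Real.cos (β * Real.pi / 2 / 2) with hcdef
  set h := stepSize β with hhdef
  set M := ∑' j : ℕ, Real.exp (-Real.sqrt (j * h)) with hM
  have hT : Tendsto (fun n : ℕ => truncParam h n) atTop atTop := by
    unfold truncParam
    refine Real.tendsto_sqrt_atTop.comp ?_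
    have : Tendsto (fun n : ℕ => (n : ℝ) * (h / 4)) atTop atTop :=
      tendsto_natCast_atTop_atTop.atTop_mul_const (by positivity)
    refine this.congr fun n => by ring
  refine ⟨max (3 + 6 / c + C + 8)
    (Real.sqrt h / c * M * Real.exp (4 + 2 * β) + Real.exp (2 + β)), ?_⟩
  filter_upwards [hC, hT.eventually_ge_atTop 1] with n hn hT1 z hz
  obtain ⟨r, ψ, hr0, hr1, hψ, hzr, hzf⟩ := exists_angle_of_mem_vShape hβ₀ hz
  rcases le_or_gt (Real.exp (4 + 2 * β - 2 * truncParam h n)) r with hr | hr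
  · have := norm_trapezoid_sub_sqrt_le hβ₀ hβ₂ rfl hT1 hr hr1 hψ hzr (hn _ rfl r hr hr1 z hzf)
    rw [Finset.mul_sum, ← hhdef] at this
    simp only [stepSize_mul_trapIntegrand hh] at this
    exact this.trans (mul_le_mul_of_nonneg_right (le_max_left _ _) (Real.exp_pos _).le)
  -- Near the tip there is no cancellation to exploit: $|\sqrt z|=\sqrt r\le e^{2+\beta-T}$, and the
  -- sum is $O(re^{T})=O(e^{-T})$.
  · refine le_trans ?_ (mul_le_mul_of_nonneg_right (le_max_right _ _) (Real.exp_pos _).le)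
    set T := truncParam h n
    have hzn : ‖z‖ = r := by
      rw [hzr, norm_mul, mul_comm Complex.I, Complex.norm_exp_ofReal_mul_I, mul_one,
        Complex.norm_real, Real.norm_of_nonneg hr0]
    have hsq : ‖Complex.sqrt z‖ ≤ Real.exp (2 + β) * Real.exp (-T) := by
      refine abs_le_of_sq_le_sq' ?_ (by positivity) |>.2
      rw [← norm_pow, Complex.sqrt_sq', hzn, ← Real.exp_add, ← Real.exp_nat_mul]
      refine hr.le.trans (Real.exp_le_exp.2 (le_of_eq ?_))
      push_cast; ring
    have hsum : ‖∑ j ∈ Finset.Icc 1 n, (trapWeight h T j : ℂ) *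
        (z / (z + Real.exp (2 * (Real.sqrt (j * h) - T))))‖ ≤
        Real.sqrt h / c * M * Real.exp (4 + 2 * β) * Real.exp (-T) := by
      calc _ ≤ ∑ j ∈ Finset.Icc 1 n,
            Real.sqrt h / c * r * Real.exp T * Real.exp (-Real.sqrt (j * h)) := by
            refine norm_sum_le_of_le _ fun j hj => ?_
            refine (norm_trapWeight_mul_le hβ₀ hβ₂ hh hr0 hψ hzr (Finset.mem_Icc.1 hj).1).trans_eq ?_
            rw [sub_eq_add_neg, Real.exp_add]
            ring
        _ = Real.sqrt h / c * r * Real.exp T *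
            ∑ j ∈ Finset.Icc 1 n, Real.exp (-Real.sqrt (j * h)) := by rw [Finset.mul_sum]
        _ ≤ Real.sqrt h / c * Real.exp (4 + 2 * β - 2 * T) * Real.exp T * M := by
            gcongr
            exact (summable_exp_neg_sqrt hh).sum_le_tsum _ fun _ _ => (Real.exp_pos _).le
        _ = Real.sqrt h / c * M * (Real.exp (4 + 2 * β - 2 * T) * Real.exp T) := by ring
        _ = Real.sqrt h / c * M * (Real.exp (4 + 2 * β) * Real.exp (-T)) := by
            rw [← Real.exp_add, ← Real.exp_add]
            ring_nf
        _ = _ := by ring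
    refine (norm_sub_le _ _).trans ?_
    linarith

/-! ### Replacing the far poles by polynomials. -/

/-- The Taylor polynomial, with `m` terms, of `1 / (z - p)` about `z = 1`. -/
noncomputable def invSubTaylor (p : ℂ) (m : ℕ) : Polynomial ℂ :=
  ∑ k ∈ Finset.range m,
    Polynomial.C ((1 - p)⁻¹ * ((1 - p)⁻¹) ^ k) * (1 - Polynomial.X) ^ k

lemma natDegree_X_mul_invSubTaylor_le (p : ℂ) (m : ℕ) :
    (Polynomial.X * invSubTaylor p m).natDegree ≤ m := by
  rw [invSubTaylor, Finset.mul_sum]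
  refine Polynomial.natDegree_sum_le_of_forall_le _ _ fun k hk => ?_
  have hk' := Finset.mem_range.1 hk
  have h1 : (1 - Polynomial.X : Polynomial ℂ).natDegree ≤ 1 := by
    refine (Polynomial.natDegree_sub_le _ _).trans ?_
    simp
  refine Polynomial.natDegree_mul_le.trans ?_
  have h2 := (Polynomial.natDegree_C_mul_le ((1 - p)⁻¹ * ((1 - p)⁻¹) ^ k)
    ((1 - Polynomial.X) ^ k)).trans (Polynomial.natDegree_pow_le_of_le k h1)
  have h3 := Polynomial.natDegree_X_le (R := ℂ)
  omega

/-- A geometric series in $(1-z)/(1-p)$, since $z-p=(1-p)-(1-z)$. -/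
lemma inv_sub_sub_eval_invSubTaylor {p z : ℂ} (hp : 1 - p ≠ 0) (hz : z - p ≠ 0) (m : ℕ) :
    1 / (z - p) - (invSubTaylor p m).eval z = ((1 - z) / (1 - p)) ^ m / (z - p) := by
  have h1 : (invSubTaylor p m).eval z =
      (1 - p)⁻¹ * ∑ k ∈ Finset.range m, ((1 - z) / (1 - p)) ^ k := by
    rw [invSubTaylor, Polynomial.eval_finsetSum, Finset.mul_sum]
    refine Finset.sum_congr rfl fun k _ => ?_
    simp only [Polynomial.eval_mul, Polynomial.eval_C, Polynomial.eval_pow, Polynomial.eval_sub,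
      Polynomial.eval_one, Polynomial.eval_X]
    rw [div_pow, inv_pow]
    ring
  have h2 := mul_neg_geom_sum ((1 - z) / (1 - p)) m
  have h3 : 1 - (1 - z) / (1 - p) = (z - p) / (1 - p) := by field_simp; ring
  rw [h3] at h2
  rw [h1, sub_eq_iff_eq_add, ← sub_eq_iff_eq_add', div_sub_div_same, ← h2]
  field_simp

/-- The V-shaped domain lies in a disc about `1` of radius less than `2`. -/
lemma norm_one_sub_div_two_le {φ ψ r : ℝ} {z : ℂ} (hφ0 : 0 ≤ φ) (hφ : φ < Real.pi)
    (hψ : |ψ| = φ) (hr0 : 0 ≤ r) (hr1 : r ≤ 1) (hz : z = r * Complex.exp (Complex.I * ψ)) :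
    ‖1 - z‖ / 2 ≤ max (1 / 2) (Real.sin (φ / 2)) := by
  have hs : 0 ≤ Real.sin (φ / 2) := Real.sin_nonneg_of_nonneg_of_le_pi (by linarith) (by linarith)
  have h1 : ‖1 - Complex.exp (Complex.I * ψ)‖ = 2 * Real.sin (φ / 2) := by
    rw [norm_sub_rev, Complex.norm_exp_I_mul_ofReal_sub_one, norm_mul, Real.norm_ofNat,
      Real.norm_eq_abs]
    have h2 : |ψ / 2| = φ / 2 := by rw [abs_div, abs_two, hψ]
    rw [Real.abs_sin_eq_sin_abs_of_abs_le_pi (by rw [h2]; linarith), h2]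
  -- By convexity the distance to $1$ is controlled by the tip, at distance $1$, and the end of the
  -- ray, at distance $2\sin(\varphi/2)$.
  have h2 : 1 - z = ((1 - r : ℝ) : ℂ) + r * (1 - Complex.exp (Complex.I * ψ)) := by
    rw [hz]; push_cast; ring
  have h3 : ‖1 - z‖ ≤ (1 - r) + r * (2 * Real.sin (φ / 2)) := by
    rw [h2]
    refine (norm_add_le _ _).trans_eq ?_
    rw [norm_mul, h1, Complex.norm_real, Complex.norm_real, Real.norm_of_nonneg hr0,
      Real.norm_of_nonneg (by linarith)]
  have h4 := le_max_left (1 / 2) (Real.sin (φ / 2))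
  have h5 := le_max_right (1 / 2) (Real.sin (φ / 2))
  nlinarith

lemma max_half_sin_lt_one {φ : ℝ} (hφ0 : 0 ≤ φ) (hφ : φ < Real.pi) :
    max (1 / 2) (Real.sin (φ / 2)) < 1 := by
  refine max_lt (by norm_num) ?_
  rw [← Real.sin_pi_div_two]
  exact Real.sin_lt_sin_of_lt_of_le_pi_div_two (by linarith) le_rfl (by linarith)

/-- Replacing a far pole by a Taylor polynomial. -/
lemma norm_trapWeight_mul_sub_taylor_le {β h T r ψ : ℝ} {z : ℂ} (hβ₀ : 0 ≤ β) (hβ₂ : β < 2)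
    (hh : 0 < h) (hr0 : 0 ≤ r) (hr1 : r ≤ 1) (hψ : |ψ| = β * Real.pi / 2)
    (hz : z = r * Complex.exp (Complex.I * ψ)) {j : ℕ} (hj : 1 ≤ j) (hT : T ≤ Real.sqrt (j * h))
    (m : ℕ) {p : ℂ} (hp : p = -(Real.exp (2 * (Real.sqrt (j * h) - T)) : ℝ)) :
    ‖(trapWeight h T j : ℂ) * (z / (z + Real.exp (2 * (Real.sqrt (j * h) - T)))) -
      trapWeight h T j * (z * (invSubTaylor p m).eval z)‖ ≤
      Real.sqrt h / Real.cos (β * Real.pi / 2 / 2) *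
        max (1 / 2) (Real.sin (β * Real.pi / 2 / 2)) ^ m := by
  have hpi := Real.pi_pos
  have hc := cos_quarter_pos hβ₀ hβ₂
  have hφ0 : 0 ≤ β * Real.pi / 2 := by positivity
  have hφ : β * Real.pi / 2 < Real.pi := by nlinarith
  have hb := norm_trapWeight_mul_le (T := T) hβ₀ hβ₂ hh hr0 hψ hz hj
  set t := Real.exp (2 * (Real.sqrt (j * h) - T)) with ht
  -- A far pole satisfies $p\le-1$, so $|1-p|\ge2$ exceeds the radius of the disc containing the V.
  have ht1 : 1 ≤ t := Real.one_le_exp (by linarith)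
  have hzp : z - p = z + t := by rw [hp]; ring
  have h1p : 1 - p = ((1 + t : ℝ) : ℂ) := by rw [hp]; push_cast; ring
  have hp0 : 1 - p ≠ 0 := by rw [h1p]; exact_mod_cast (by linarith : (1 + t : ℝ) ≠ 0)
  have hz0 : z - p ≠ 0 := by
    have := cos_half_mul_le_norm_add (s := t) hφ0 hφ hψ hz
    rw [add_comm _ z, ← hzp] at this
    exact norm_pos_iff.1 (lt_of_lt_of_le (by positivity) this)
  have e : (trapWeight h T j : ℂ) * (z / (z + t)) -
      trapWeight h T j * (z * (invSubTaylor p m).eval z) =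
      trapWeight h T j * (z / (z + t)) * ((1 - z) / (1 - p)) ^ m := by
    have h2 := inv_sub_sub_eval_invSubTaylor hp0 hz0 m
    rw [hzp] at h2
    linear_combination (trapWeight h T j * z : ℂ) * h2
  have hw : ‖(1 - z) / (1 - p)‖ ≤ max (1 / 2) (Real.sin (β * Real.pi / 2 / 2)) := by
    refine le_trans ?_ (norm_one_sub_div_two_le hφ0 hφ hψ hr0 hr1 hz)
    rw [norm_div, h1p, Complex.norm_real, Real.norm_of_nonneg (by linarith)]
    gcongr
    linarith
  rw [e, norm_mul, norm_pow]
  have h5 : Real.exp (T - Real.sqrt (j * h)) ≤ 1 := Real.exp_le_one_iff.2 (by linarith)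
  have h6 : Real.sqrt h / Real.cos (β * Real.pi / 2 / 2) * r * Real.exp (T - Real.sqrt (j * h)) ≤
      Real.sqrt h / Real.cos (β * Real.pi / 2 / 2) * 1 * 1 := by gcongr
  rw [mul_one, mul_one] at h6
  exact mul_le_mul (hb.trans h6) (pow_le_pow_left₀ (norm_nonneg _) hw m) (by positivity)
    (by positivity)

/-! ### From the trapezoidal sum to the lightning + polynomial approximant. -/

/-- With $4N$ nodes $T=\sqrt{Nh}$, and $\sigma=2\sqrt h$. -/
lemma taperedPole_eq {β : ℝ} (hβ₂ : β < 2) (N j : ℕ) :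
    taperedPole (2 * Real.sqrt (2 - β) * Real.pi) N j =
      -Real.exp (2 * (Real.sqrt (j * stepSize β) - truncParam (stepSize β) (4 * N))) := by
  have h1 : ∀ x : ℝ, 0 ≤ x → Real.sqrt (x * stepSize β) =
      Real.sqrt x * (Real.sqrt (2 - β) * Real.pi) := fun x hx => by
    rw [stepSize, Real.sqrt_mul hx, Real.sqrt_mul (by linarith), Real.sqrt_sq Real.pi_pos.le]
  have h2 : truncParam (stepSize β) (4 * N) = Real.sqrt (N * stepSize β) := by
    rw [truncParam]
    congr 1
    push_cast
    ring
  rw [taperedPole, h2, h1 _ (Nat.cast_nonneg _), h1 _ (Nat.cast_nonneg _)]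
  congr 2
  ring

/-- The polynomial part: constant terms of the near poles and Taylor polynomials of the far poles. -/
noncomputable def trapPoly (β : ℝ) (N m : ℕ) : Polynomial ℂ :=
  Polynomial.C (∑ j ∈ Finset.Icc 1 N,
      (trapWeight (stepSize β) (truncParam (stepSize β) (4 * N)) j : ℂ)) +
    ∑ j ∈ Finset.Ioc N (4 * N),
      Polynomial.C (trapWeight (stepSize β) (truncParam (stepSize β) (4 * N)) j : ℂ) *
        (Polynomial.X *
          invSubTaylor (taperedPole (2 * Real.sqrt (2 - β) * Real.pi) N j : ℂ) m)

lemma natDegree_trapPoly_le (β : ℝ) (N m : ℕ) : (trapPoly β N m).natDegree ≤ m := by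
  refine (Polynomial.natDegree_add_le _ _).trans (max_le ((Polynomial.natDegree_C _).trans_le
    (Nat.zero_le _)) ?_)
  refine Polynomial.natDegree_sum_le_of_forall_le _ _ fun j _ => ?_
  exact (Polynomial.natDegree_C_mul_le _ _).trans (natDegree_X_mul_invSubTaylor_le _ _)

/-- The coefficients of the lightning part. -/
noncomputable def trapCoeff (β : ℝ) (N j : ℕ) : ℂ :=
  (trapWeight (stepSize β) (truncParam (stepSize β) (4 * N)) j : ℂ) *
    taperedPole (2 * Real.sqrt (2 - β) * Real.pi) N j

lemma trapCoeff_ne_zero {β : ℝ} (hβ₂ : β < 2) {N j : ℕ} (hj : 1 ≤ j) : trapCoeff β N j ≠ 0 := by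
  have hh := stepSize_pos hβ₂
  have hj' : (0 : ℝ) < j := by exact_mod_cast hj
  have hpi := Real.pi_pos
  refine mul_ne_zero (Complex.ofReal_ne_zero.2 ?_) (Complex.ofReal_ne_zero.2 ?_)
  · unfold trapWeight
    have : 0 < Real.sqrt (j * stepSize β) := Real.sqrt_pos.2 (by positivity)
    positivity
  · exact neg_ne_zero.2 (Real.exp_pos _).ne'

/-- For $j\le N$ the identity $z/(z-p)=1+p/(z-p)$ makes the match exact, so only the $3N$ far terms
contribute error. -/
lemma norm_lightningPoly_sub_trapezoid_le {β : ℝ} (hβ₀ : 0 ≤ β) (hβ₂ : β < 2) (N m : ℕ) {z : ℂ}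
    (hz : z ∈ vShape β) :
    ‖lightningPoly (2 * Real.sqrt (2 - β) * Real.pi) N (trapCoeff β N) (trapPoly β N m) z -
      ∑ j ∈ Finset.Icc 1 (4 * N),
        (trapWeight (stepSize β) (truncParam (stepSize β) (4 * N)) j : ℂ) *
        (z / (z + Real.exp (2 * (Real.sqrt (j * stepSize β) -
          truncParam (stepSize β) (4 * N)))))‖ ≤
      3 * N * (Real.sqrt (stepSize β) / Real.cos (β * Real.pi / 2 / 2) *
        max (1 / 2) (Real.sin (β * Real.pi / 2 / 2)) ^ m) := by
  obtain ⟨r, ψ, hr0, hr1, hψ, hzr, -⟩ := exists_angle_of_mem_vShape hβ₀ hz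
  have hpi := Real.pi_pos
  have hc := cos_quarter_pos hβ₀ hβ₂
  have hh := stepSize_pos hβ₂
  have hφ0 : 0 ≤ β * Real.pi / 2 := by positivity
  have hφ : β * Real.pi / 2 < Real.pi := by nlinarith
  have hpole : ∀ j : ℕ, (taperedPole (2 * Real.sqrt (2 - β) * Real.pi) N j : ℂ) =
      -(Real.exp (2 * (Real.sqrt (j * stepSize β) - truncParam (stepSize β) (4 * N))) : ℝ) :=
    fun j => by rw [taperedPole_eq hβ₂, Complex.ofReal_neg]
  set h := stepSize β
  set T := truncParam h (4 * N) with hT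
  have hden : ∀ j : ℕ, z + Real.exp (2 * (Real.sqrt (j * h) - T)) ≠ (0 : ℂ) := fun j => by
    have := cos_half_mul_le_norm_add (s := Real.exp (2 * (Real.sqrt (j * h) - T))) hφ0 hφ hψ hzr
    rw [add_comm _ z] at this
    exact norm_pos_iff.1 (lt_of_lt_of_le (by positivity) this)
  have hsplit : Finset.Icc 1 (4 * N) = Finset.Icc 1 N ∪ Finset.Ioc N (4 * N) := by
    ext j
    simp only [Finset.mem_Icc, Finset.mem_union, Finset.mem_Ioc]
    omega
  have hdisj : Disjoint (Finset.Icc 1 N) (Finset.Ioc N (4 * N)) := by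
    rw [Finset.disjoint_left]
    intro j h1 h2
    have := (Finset.mem_Icc.1 h1).2
    have := (Finset.mem_Ioc.1 h2).1
    omega
  have hnear : ∀ j ∈ Finset.Icc 1 N, (trapWeight h T j : ℂ) *
      (z / (z + Real.exp (2 * (Real.sqrt (j * h) - T)))) =
      trapCoeff β N j / (z - taperedPole (2 * Real.sqrt (2 - β) * Real.pi) N j) +
        trapWeight h T j := by
    intro j _
    have h0 := hden j
    rw [trapCoeff, hpole, sub_neg_eq_add]
    field_simp
    ring
  have heq : lightningPoly (2 * Real.sqrt (2 - β) * Real.pi) N (trapCoeff β N)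
      (trapPoly β N m) z - ∑ j ∈ Finset.Icc 1 (4 * N), (trapWeight h T j : ℂ) *
        (z / (z + Real.exp (2 * (Real.sqrt (j * h) - T)))) =
      -∑ j ∈ Finset.Ioc N (4 * N), ((trapWeight h T j : ℂ) *
        (z / (z + Real.exp (2 * (Real.sqrt (j * h) - T)))) - trapWeight h T j *
          (z * (invSubTaylor (taperedPole (2 * Real.sqrt (2 - β) * Real.pi) N j : ℂ) m).eval z)) := by
    rw [hsplit, Finset.sum_union hdisj, Finset.sum_congr rfl hnear, Finset.sum_add_distrib,
      Finset.sum_sub_distrib, lightningPoly, trapPoly, Polynomial.eval_add, Polynomial.eval_C,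
      Polynomial.eval_finsetSum]
    simp only [Polynomial.eval_mul, Polynomial.eval_C, Polynomial.eval_X]
    ring
  rw [heq, norm_neg]
  refine (norm_sum_le_of_le _ fun j hj => norm_trapWeight_mul_sub_taylor_le hβ₀ hβ₂ hh hr0 hr1 hψ
    hzr (by have := (Finset.mem_Ioc.1 hj).1; omega) ?_ m (hpole j)).trans ?_
  · rw [hT, truncParam]
    apply Real.sqrt_le_sqrt
    have : (N : ℝ) ≤ j := by exact_mod_cast (Finset.mem_Ioc.1 hj).1.le
    push_cast
    nlinarith
  · rw [Finset.sum_const, Nat.card_Ioc, nsmul_eq_mul]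
    refine le_of_eq ?_
    congr 1
    rw [Nat.cast_sub (by omega)]
    push_cast
    ring

/-- Since $(\sqrt x+K)^2\ge x+n$, enlarging $x$ by $O(\sqrt x)$ costs a constant factor in the rate.
-/
lemma exp_neg_mul_sqrt_le {s K x n : ℝ} (hs : 0 ≤ s) (hK : 0 ≤ K) (hx : 0 ≤ x)
    (hn : n ≤ K * Real.sqrt x) :
    Real.exp (-(s * Real.sqrt x)) ≤ Real.exp (s * K) * Real.exp (-(s * Real.sqrt (x + n))) := by
  have h1 : Real.sqrt (x + n) ≤ Real.sqrt x + K := by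
    apply Real.sqrt_le_iff.2
    refine ⟨by positivity, ?_⟩
    nlinarith [Real.sq_sqrt hx, Real.sqrt_nonneg x]
  rw [← Real.exp_add]
  apply Real.exp_le_exp.2
  nlinarith

theorem mainTheorem4 (β : ℝ) (hβ₀ : 0 ≤ β) (hβ₂ : β < 2)
    (hconj : ContourBoundConjecture β) :
    ∃ (N₂ : ℕ → ℕ) (a : ℕ → ℕ → ℂ) (b : ℕ → Polynomial ℂ),
      ((fun N₁ : ℕ => (N₂ N₁ : ℝ)) =O[atTop] fun N₁ : ℕ => Real.sqrt N₁) ∧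
      (∀ N₁ : ℕ, (b N₁).natDegree = N₂ N₁) ∧
      (∀ N₁ : ℕ, ∀ j ∈ Finset.Icc 1 N₁, a N₁ j ≠ 0) ∧
      ∃ C : ℝ, ∀ᶠ N₁ : ℕ in atTop, ∀ z ∈ vShape β,
        ‖lightningPoly (2 * Real.sqrt (2 - β) * Real.pi) N₁ (a N₁) (b N₁) z - Complex.sqrt z‖ ≤
          C * Real.exp (-Real.pi * Real.sqrt ((2 - β) * ((N₁ + N₂ N₁ : ℕ) : ℝ))) := by
  have hpi := Real.pi_pos
  have hc := cos_quarter_pos hβ₀ hβ₂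
  have hφ0 : 0 ≤ β * Real.pi / 2 := by positivity
  have hφ : β * Real.pi / 2 < Real.pi := by nlinarith
  have hq1 := max_half_sin_lt_one hφ0 hφ
  set q := max (1 / 2) (Real.sin (β * Real.pi / 2 / 2)) with hq
  have hq0 : 0 < q := lt_of_lt_of_le (by norm_num) (le_max_left _ _)
  have hlq : Real.log q < 0 := Real.log_neg hq0 hq1
  set S := Real.pi * Real.sqrt (2 - β) with hS
  have hS0 : 0 ≤ S := by positivity
  -- Chosen so that $q^{K\sqrt N}=e^{-(S+1)\sqrt N}$: `S` is the target rate, and the extra `1`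
  -- absorbs the number $3N$ of far terms.
  set K := (S + 1) / -Real.log q with hK
  have hK0 : 0 < K := div_pos (by linarith) (by linarith)
  have hKq : K * Real.log q = -(S + 1) := by
    rw [hK]
    have : Real.log q ≠ 0 := hlq.ne
    field_simp
  set m : ℕ → ℕ := fun N => ⌈K * Real.sqrt N⌉₊ with hm
  have hmle : ∀ N : ℕ, 1 ≤ N → (m N : ℝ) ≤ (K + 1) * Real.sqrt N := by
    intro N hN
    have h1 : 1 ≤ Real.sqrt N := Real.one_le_sqrt.2 (by exact_mod_cast hN)
    have h2 := (Nat.ceil_lt_add_one (by positivity : 0 ≤ K * Real.sqrt N)).le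
    simp only [hm]
    linarith
  have hN₂ : ∀ N : ℕ, 1 ≤ N → ((trapPoly β N (m N)).natDegree : ℝ) ≤ (K + 1) * Real.sqrt N :=
    fun N hN => le_trans (by exact_mod_cast natDegree_trapPoly_le β N (m N)) (hmle N hN)
  have hTN : ∀ N : ℕ, truncParam (stepSize β) (4 * N) = S * Real.sqrt N := by
    intro N
    rw [truncParam, stepSize, show ((4 * N : ℕ) : ℝ) * ((2 - β) * Real.pi ^ 2) / 4 =
      Real.pi ^ 2 * ((2 - β) * N) by push_cast; ring, Real.sqrt_mul (by positivity),
      Real.sqrt_mul (by linarith), Real.sqrt_sq hpi.le, hS, mul_assoc]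
  obtain ⟨C, hC⟩ := exists_trapezoid_error_bound hβ₀ hβ₂ hconj
  have h4 : Tendsto (fun N : ℕ => 4 * N) atTop atTop :=
    tendsto_id.const_mul_atTop' (by norm_num)
  -- $N_2$ is taken to be the actual degree, for which only the upper bound `m N` is needed; no
  -- leading coefficient has to be examined.
  refine ⟨fun N => (trapPoly β N (m N)).natDegree, fun N => trapCoeff β N,
    fun N => trapPoly β N (m N), ?_, fun _ => rfl,
    fun N j hj => trapCoeff_ne_zero hβ₂ (Finset.mem_Icc.1 hj).1, ?_⟩
  · refine IsBigO.of_bound (K + 1) ?_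
    filter_upwards [eventually_ge_atTop 1] with N hN
    rw [Real.norm_of_nonneg (Nat.cast_nonneg _), Real.norm_of_nonneg (Real.sqrt_nonneg _)]
    exact hN₂ N hN
  set D := Real.sqrt (stepSize β) / Real.cos (β * Real.pi / 2 / 2) with hD
  have hD0 : 0 ≤ D := by positivity
  refine ⟨(6 * D + |C|) * Real.exp (S * (K + 1)), ?_⟩
  filter_upwards [h4.eventually hC, eventually_ge_atTop 1] with N hN hN1 z hz
  have hsqN := Real.sqrt_nonneg (N : ℝ)
  have h1 := norm_lightningPoly_sub_trapezoid_le hβ₀ hβ₂ N (m N) hz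
  have h2 := hN z hz
  rw [← hq, ← hD] at h1
  have hqm : q ^ m N ≤ Real.exp (-(S * Real.sqrt N)) * Real.exp (-Real.sqrt N) := by
    rw [← Real.exp_add, ← Real.exp_log hq0, ← Real.exp_nat_mul]
    apply Real.exp_le_exp.2
    have h3 : K * Real.sqrt N ≤ m N := Nat.le_ceil _
    nlinarith
  have hNe : (N : ℝ) * Real.exp (-Real.sqrt N) ≤ 2 := by
    have h3 := Real.quadratic_le_exp_of_nonneg hsqN
    rw [Real.sq_sqrt (Nat.cast_nonneg _)] at h3
    rw [Real.exp_neg, ← div_eq_mul_inv, div_le_iff₀ (Real.exp_pos _)]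
    linarith
  have h3 : 3 * N * (D * q ^ m N) ≤ 6 * D * Real.exp (-(S * Real.sqrt N)) := by
    calc 3 * N * (D * q ^ m N) ≤
        3 * N * (D * (Real.exp (-(S * Real.sqrt N)) * Real.exp (-Real.sqrt N))) := by gcongr
      _ = 3 * D * Real.exp (-(S * Real.sqrt N)) * (N * Real.exp (-Real.sqrt N)) := by ring
      _ ≤ 3 * D * Real.exp (-(S * Real.sqrt N)) * 2 := by gcongr
      _ = _ := by ring
  have h5 := exp_neg_mul_sqrt_le hS0 (by linarith : 0 ≤ K + 1) (Nat.cast_nonneg N) (hN₂ N hN1)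
  have h6 : -Real.pi * Real.sqrt ((2 - β) * ((N + (trapPoly β N (m N)).natDegree : ℕ) : ℝ)) =
      -(S * Real.sqrt (N + (trapPoly β N (m N)).natDegree)) := by
    rw [Real.sqrt_mul (by linarith), hS]
    push_cast
    ring
  rw [h6]
  rw [hTN] at h1 h2
  have h7 := norm_sub_le_norm_sub_add_norm_sub
    (lightningPoly (2 * Real.sqrt (2 - β) * Real.pi) N (trapCoeff β N) (trapPoly β N (m N)) z)
    (∑ j ∈ Finset.Icc 1 (4 * N), (trapWeight (stepSize β) (S * Real.sqrt N) j : ℂ) *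
        (z / (z + Real.exp (2 * (Real.sqrt (j * stepSize β) - (S * Real.sqrt N : ℝ))))))
    (Complex.sqrt z)
  have h8 : C * Real.exp (-(S * Real.sqrt N)) ≤ |C| * Real.exp (-(S * Real.sqrt N)) := by
    gcongr
    exact le_abs_self C
  calc _ ≤ (6 * D + |C|) * Real.exp (-(S * Real.sqrt N)) := by linarith
    _ ≤ (6 * D + |C|) * (Real.exp (S * (K + 1)) *
        Real.exp (-(S * Real.sqrt (N + (trapPoly β N (m N)).natDegree)))) := by gcongr
    _ = _ := by ring
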